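/- Let $G$ be a countable group. Let $\mathrm{Sub}_G\subset 2^G$ be the compact space of subgroups of $G$, with the topology induced by the product topology on $2^G$, and let $\eta$ be a Borel probability measure on $\mathrm{Sub}_G$ that is invariant under conjugation by $G$. Call $\eta$ *sofic* if for every $\delta>0$, every finite $K\subset G$ and every open neighbourhood $\Omega$ of $\eta$ in the space of Borel probability measures on $2^G$ (weak topology; $\eta$ is regarded as a measure on $2^G$) there are an integer $d>0$ and a map $\sigma:G\to\mathrm{Sym}(d)$ such that (1) $d^{-1}|\{q:\sigma(g)\sigma(h)q=\sigma(gh)q\}|\ge 1-\delta$ for all $g,h\in K$, and (2) if $u_d$ is the uniform probability measure on $\{1,\dots,d\}$ and $\mathrm{Stab}_\sigma(q)=\{g\in G:\sigma(g)q=q\}\in 2^G$, then $(\mathrm{Stab}_\sigma)_*u_d\in\Omega$. Let $(Z,\zeta)$ be a non-atomic standard probability space. Let $\mathrm{Sub}_G\otimes Z$ be the set of pairs $(L,\omega)$ with $L\in\mathrm{Sub}_G$ and $\omega:G/L\to Z$, with the Borel structure induced by the embedding $(L,\omega)\mapsto(L,\,g\mapsto\omega(gL))$ into $\mathrm{Sub}_G\times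 Z^G$. The group $G$ acts on it by $g(L,\omega)=(gLg^{-1},g\omega)$, where $(g\omega)(f\,gLg^{-1})=\omega(fgL)$, and this action preserves the probability measure $\eta\otimes\zeta$ given by $d(\eta\otimes\zeta)(L,\omega)=d\zeta^{G/L}(\omega)\,d\eta(L)$. The *principal groupoid* of a measure-preserving action of $G$ on a standard probability space $(X,\mu)$ is the discrete pmp groupoid $(\mathcal H,\nu)$ with $\mathcal H=\{(x,y)\in X\times X:\exists g\in G,\ gx=y\}$, units $\mathcal H^0=\{(x,x):x\in X\}\cong X$, $\nu$ the image of $\mu$ under $x\mapsto(x,x)$, source $\mathfrak s(x,y)=(y,y)$, range $\mathfrak r(x,y)=(x,x)$, product $(x,y)(y,z)=(x,z)$ and inverse $(x,y)^{-1}=(y,x)$. For a discrete pmp groupoid $(\mathcal H,\nu)$ extend $\nu$ to Borel sets $B\subset\mathcal H$ by $\nu(B)=\int_{\mathcal H^0}|\mathfrak s^{-1}(x)\cap B|\,d\nu(x)$. Let $[[\mathcal H]]$ be the set of Borel subsets $f\subset\mathcal H$ on which $\mathfrak s$ and $\mathfrak r$ restrict to Borel isomorphisms onto their images, with the product $fg=\{f'g':f'\in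 f,\ g'\in g,\ \mathfrak s(f')=\mathfrak r(g')\}$, and let $\mathrm{tr}_{\mathcal H}(f)=\nu(f\cap\mathcal H^0)$. For an integer $d>0$ let $[[d]]$ be the set of subsets of $\{1,\dots,d\}^2$ on which both coordinate projections are injective, with the product given by $(i,j)(j,k)=(i,k)$. For $E\subset\{1,\dots,d\}^2$ put $|E|_d=|E|/d$, and for $f\in[[d]]$ put $\mathrm{tr}_d(f)=|\{(i,i)\in f\}|/d$. Give the set of maps $[[\mathcal H]]\to[[d]]$ the $\sigma$-algebra generated by the sets $\{\sigma':\sigma'|_F=\sigma|_F\}$ with $F\subset[[\mathcal H]]$ finite and $\sigma:[[\mathcal H]]\to[[d]]$. The groupoid $(\mathcal H,\nu)$ is *sofic* if there are a nonempty directed set $J$, integers $d_j>0$ and probability measures $\mathbb P_j$ on the set of maps $[[\mathcal H]]\to[[d_j]]$ $(j\in J)$ such that (i) for all finite $F\subset[[\mathcal H]]$ and $\delta>0$, $\lim_{j}\mathbb P_j\{\sigma:|\mathrm{tr}_{d_j}(\sigma(s))-\mathrm{tr}_{\mathcal H}(s)|<\delta\ \forall s\in F\}=1$; (ii) for all finite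 $F\subset[[\mathcal H]]$ and $\delta>0$ there is $j\in J$ such that for every $j'\ge j$ and $\mathbb P_{j'}$-almost every $\sigma$, $|\sigma(st)\,\triangle\,\sigma(s)\sigma(t)|_{d_{j'}}<\delta$ for all $s,t\in F$; (iii) $\lim_j d_j=+\infty$; (iv) for all $f,f'\in[[\mathcal H]]$ with $\nu(f\,\triangle\,f')=0$ and every $j\in J$, $\sigma(f)=\sigma(f')$ for $\mathbb P_j$-almost every $\sigma$. **Proposition.** If $\eta$ is a sofic conjugation-invariant Borel probability measure on $\mathrm{Sub}_G$, then the principal groupoid of the action $G\curvearrowright(\mathrm{Sub}_G\otimes Z,\eta\otimes\zeta)$ is sofic. -/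

import Mathlib

open MeasureTheory Set Filter Topology
open scoped ENNReal

universe u v w

noncomputable section

namespace SoficGroupoid

/-! ## Discrete pmp groupoids -/

/-- A discrete probability-measure-preserving groupoid with standard Borel space of objects `Ob`
and standard Borel space of morphisms `H`. The product `comp f g` is defined exactly when
`src f = rng g`. The Borel sets "units" and "composable pairs" are not listed as fields: they are
Borel automatically, being the range of the Borel injection `unit` and the coincidence set
of two Borel maps. -/
structure PMPGroupoid (Ob : Type u) (H : Type v) [MeasurableSpace Ob] [StandardBorelSpace Ob]
    [MeasurableSpace H] [StandardBorelSpace H] where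
  src : H → Ob
  rng : H → Ob
  unit : Ob → H
  inv : H → H
  comp : (f g : H) → src f = rng g → H
  src_unit : ∀ x, src (unit x) = x
  rng_unit : ∀ x, rng (unit x) = x
  src_comp : ∀ f g h, src (comp f g h) = src g
  rng_comp : ∀ f g h, rng (comp f g h) = rng f
  comp_assoc : ∀ (f g k : H) (h₁ : src f = rng g) (h₂ : src g = rng k),
    comp (comp f g h₁) k ((src_comp f g h₁).trans h₂) =
      comp f (comp g k h₂) (h₁.trans (rng_comp g k h₂).symm)
  comp_unit : ∀ f, comp f (unit (src f)) (rng_unit _).symm = f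
  unit_comp : ∀ f, comp (unit (rng f)) f (src_unit _) = f
  src_inv : ∀ f, src (inv f) = rng f
  rng_inv : ∀ f, rng (inv f) = src f
  inv_comp : ∀ f, comp (inv f) f (src_inv f) = unit (src f)
  comp_inv : ∀ f, comp f (inv f) (rng_inv f).symm = unit (rng f)
  measurable_src : Measurable src
  measurable_rng : Measurable rng
  measurable_unit : Measurable unit
  measurable_inv : Measurable inv
  measurable_comp : Measurable fun p : {p : H × H // src p.1 = rng p.2} => comp p.1.1 p.1.2 p.2
  countable_src : ∀ x, (src ⁻¹' {x}).Countable
  countable_rng : ∀ x, (rng ⁻¹' {x}).Countable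
  ν : Measure Ob
  isProbabilityMeasure : IsProbabilityMeasure ν
  pmp : ∀ B : Set H, MeasurableSet B →
    ∫⁻ x, ((src ⁻¹' {x} ∩ B).encard : ℝ≥0∞) ∂ν = ∫⁻ x, ((rng ⁻¹' {x} ∩ B).encard : ℝ≥0∞) ∂ν

namespace PMPGroupoid

variable {Ob : Type u} {H : Type v} [MeasurableSpace Ob] [StandardBorelSpace Ob]
  [MeasurableSpace H] [StandardBorelSpace H] (𝓗 : PMPGroupoid Ob H)

/-- The extension of the measure on objects to Borel sets of morphisms (integrated size of the
source fibres, which equals the integrated size of the range fibres). -/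
def mass (B : Set H) : ℝ≥0∞ := ∫⁻ x, ((𝓗.src ⁻¹' {x} ∩ B).encard : ℝ≥0∞) ∂𝓗.ν

/-- `f` is a Borel set of morphisms on which source and range restrict to Borel isomorphisms
onto their images. -/
structure IsPartialAut (f : Set H) : Prop where
  measurableSet : MeasurableSet f
  src : MeasurableEmbedding fun h : f => 𝓗.src h
  rng : MeasurableEmbedding fun h : f => 𝓗.rng h

/-- The set of partial automorphisms `[[H]]`. -/
def PartialAut : Type v := {f : Set H // 𝓗.IsPartialAut f}

/-- The product of two sets of morphisms. -/
def setMul (f g : Set H) : Set H :=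
  {h | ∃ a ∈ f, ∃ b ∈ g, ∃ hab : 𝓗.src a = 𝓗.rng b, h = 𝓗.comp a b hab}

theorem IsPartialAut.setMul {f g : Set H} (hf : 𝓗.IsPartialAut f) (hg : 𝓗.IsPartialAut g) :
    𝓗.IsPartialAut (𝓗.setMul f g) := by
  have injf : ∀ a ∈ f, ∀ b ∈ f, 𝓗.src a = 𝓗.src b → a = b := fun a ha b hb h =>
    congrArg Subtype.val (hf.src.injective (a₁ := ⟨a, ha⟩) (a₂ := ⟨b, hb⟩) h)
  have injf2 : ∀ a ∈ f, ∀ b ∈ f, 𝓗.rng a = 𝓗.rng b → a = b := fun a ha b hb h =>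
    congrArg Subtype.val (hf.rng.injective (a₁ := ⟨a, ha⟩) (a₂ := ⟨b, hb⟩) h)
  have injg : ∀ a ∈ g, ∀ b ∈ g, 𝓗.src a = 𝓗.src b → a = b := fun a ha b hb h =>
    congrArg Subtype.val (hg.src.injective (a₁ := ⟨a, ha⟩) (a₂ := ⟨b, hb⟩) h)
  have injg2 : ∀ a ∈ g, ∀ b ∈ g, 𝓗.rng a = 𝓗.rng b → a = b := fun a ha b hb h =>
    congrArg Subtype.val (hg.rng.injective (a₁ := ⟨a, ha⟩) (a₂ := ⟨b, hb⟩) h)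
  have hcomp : MeasurableSet {p : H × H | 𝓗.src p.1 = 𝓗.rng p.2} :=
    measurableSet_eq_fun (𝓗.measurable_src.comp measurable_fst)
      (𝓗.measurable_rng.comp measurable_snd)
  have : StandardBorelSpace {p : H × H // 𝓗.src p.1 = 𝓗.rng p.2} := hcomp.standardBorel
  have hmeas : MeasurableSet (𝓗.setMul f g) := by
    have hT : MeasurableSet {p : {p : H × H // 𝓗.src p.1 = 𝓗.rng p.2} |
        p.1.1 ∈ f ∧ p.1.2 ∈ g} :=
      ((measurable_fst.comp measurable_subtype_coe) hf.measurableSet).inter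
        ((measurable_snd.comp measurable_subtype_coe) hg.measurableSet)
    convert hT.image_of_measurable_injOn 𝓗.measurable_comp ?_ using 1
    · ext h
      constructor
      · rintro ⟨a, ha, b, hb, hab, rfl⟩
        exact ⟨⟨(a, b), hab⟩, ⟨ha, hb⟩, rfl⟩
      · rintro ⟨⟨⟨a, b⟩, hab⟩, ⟨ha, hb⟩, rfl⟩
        exact ⟨a, ha, b, hb, hab, rfl⟩
    · rintro ⟨⟨a, b⟩, hab⟩ ⟨ha, hb⟩ ⟨⟨a', b'⟩, hab'⟩ ⟨ha', hb'⟩ h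
      have h1 := congrArg 𝓗.src h
      have h2 := congrArg 𝓗.rng h
      simp only [𝓗.src_comp, 𝓗.rng_comp] at h1 h2
      have e1 := injg b hb b' hb' h1
      have e2 := injf2 a ha a' ha' h2
      subst e1 e2
      rfl
  have : StandardBorelSpace (𝓗.setMul f g) := hmeas.standardBorel
  refine ⟨hmeas, (𝓗.measurable_src.comp measurable_subtype_coe).measurableEmbedding ?_,
    (𝓗.measurable_rng.comp measurable_subtype_coe).measurableEmbedding ?_⟩
  · rintro ⟨h, a, ha, b, hb, hab, rfl⟩ ⟨h', a', ha', b', hb', hab', rfl⟩ e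
    simp only [Function.comp, 𝓗.src_comp] at e
    have e1 := injg b hb b' hb' e
    subst e1
    have e2 := injf a ha a' ha' (hab.trans hab'.symm)
    subst e2
    rfl
  · rintro ⟨h, a, ha, b, hb, hab, rfl⟩ ⟨h', a', ha', b', hb', hab', rfl⟩ e
    simp only [Function.comp, 𝓗.rng_comp] at e
    have e1 := injf2 a ha a' ha' e
    subst e1
    have e2 := injg2 b hb b' hb' (hab.symm.trans hab')
    subst e2
    rfl

instance : Mul 𝓗.PartialAut := ⟨fun f g => ⟨𝓗.setMul f.1 g.1, f.2.setMul 𝓗 g.2⟩⟩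

/-- The trace: measure of the set of units contained in `f`. -/
def trace (f : 𝓗.PartialAut) : ℝ := 𝓗.ν.real (𝓗.unit ⁻¹' f.1)

end PMPGroupoid

/-! ## The full groupoid on `d` points -/

/-- `[[d]]`: sets of pairs on which both coordinate projections are injective. -/
def FinPartialAut (d : ℕ) : Type :=
  {f : Set (Fin d × Fin d) // InjOn Prod.fst f ∧ InjOn Prod.snd f}

namespace FinPartialAut

/-- The product, using `(i, j)(j, k) = (i, k)`. -/
instance (d : ℕ) : Mul (FinPartialAut d) where
  mul f g := ⟨{p | ∃ j, (p.1, j) ∈ f.1 ∧ (j, p.2) ∈ g.1}, by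
    obtain ⟨f, hf1, hf2⟩ := f
    obtain ⟨g, hg1, hg2⟩ := g
    constructor
    · rintro ⟨i, k⟩ ⟨j, h1, h2⟩ ⟨i', k'⟩ ⟨j', h1', h2'⟩ (rfl : i = i')
      have e := hf1 h1 h1' rfl
      simp only [Prod.mk.injEq, true_and] at e
      subst e
      have e := hg1 h2 h2' rfl
      simp only [Prod.mk.injEq, true_and] at e
      rw [e]
    · rintro ⟨i, k⟩ ⟨j, h1, h2⟩ ⟨i', k'⟩ ⟨j', h1', h2'⟩ (rfl : k = k')
      have e := hg2 h2 h2' rfl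
      simp only [Prod.mk.injEq, and_true] at e
      subst e
      have e := hf2 h1 h1' rfl
      simp only [Prod.mk.injEq, and_true] at e
      rw [e]⟩

/-- The normalized size of a set of pairs. -/
def size (d : ℕ) (E : Set (Fin d × Fin d)) : ℝ := E.ncard / d

/-- The normalized trace on `[[d]]`. -/
def trace {d : ℕ} (f : FinPartialAut d) : ℝ := size d (f.1 ∩ {p | p.1 = p.2})

end FinPartialAut

/-! ## Sofic approximations -/

namespace PMPGroupoid

variable {Ob : Type u} {H : Type v} [MeasurableSpace Ob] [StandardBorelSpace Ob]
  [MeasurableSpace H] [StandardBorelSpace H] (𝓗 : PMPGroupoid Ob H)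

/-- `Map([[H]], [[d]])`. -/
def MapTo (d : ℕ) : Type v := 𝓗.PartialAut → FinPartialAut d

/-- The sigma-algebra generated by the sets of maps that agree with a given map on a given
finite set. -/
instance (d : ℕ) : MeasurableSpace (𝓗.MapTo d) :=
  MeasurableSpace.generateFrom
    {N | ∃ (σ : 𝓗.MapTo d) (F : Finset 𝓗.PartialAut), N = {σ' | ∀ f ∈ F, σ' f = σ f}}

/-- `σ` is `(F, δ)`-multiplicative. -/
def IsMultiplicative {d : ℕ} (σ : 𝓗.MapTo d) (F : Finset 𝓗.PartialAut) (δ : ℝ) : Prop :=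
  ∀ s ∈ F, ∀ t ∈ F, FinPartialAut.size d (symmDiff (σ (s * t)).1 (σ s * σ t).1) < δ

/-- `σ` is `(F, δ)`-trace-preserving. -/
def IsTracePreserving {d : ℕ} (σ : 𝓗.MapTo d) (F : Finset 𝓗.PartialAut) (δ : ℝ) : Prop :=
  ∀ s ∈ F, |(σ s).trace - 𝓗.trace s| < δ

/-- A sofic approximation: a family of probability measures `P j` on `Map([[H]], [[d j]])` indexed
by a directed set `J`. -/
structure IsSoficApproximation {J : Type w} [Preorder J] (d : J → ℕ)
    (P : ∀ j, Measure (𝓗.MapTo (d j))) : Prop where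
  d_pos : ∀ j, 0 < d j
  isProbabilityMeasure : ∀ j, IsProbabilityMeasure (P j)
  trace_preserving : ∀ (F : Finset 𝓗.PartialAut) (δ : ℝ), 0 < δ →
    Tendsto (fun j => P j {σ | 𝓗.IsTracePreserving σ F δ}) atTop (𝓝 1)
  multiplicative : ∀ (F : Finset 𝓗.PartialAut) (δ : ℝ), 0 < δ →
    ∃ j, ∀ j', j ≤ j' → ∀ᵐ σ ∂P j', 𝓗.IsMultiplicative σ F δ
  tendsto_d : Tendsto d atTop atTop
  null : ∀ f f' : 𝓗.PartialAut, 𝓗.mass (symmDiff f.1 f'.1) = 0 →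
    ∀ j, ∀ᵐ σ ∂P j, σ f = σ f'

/-- The groupoid admits a sofic approximation, indexed by a nonempty directed set. -/
def IsSofic : Prop :=
  ∃ (J : Type v) (_ : Preorder J) (_ : IsDirectedOrder J) (_ : Nonempty J) (d : J → ℕ)
    (P : ∀ j, Measure (𝓗.MapTo (d j))), 𝓗.IsSoficApproximation d P

end PMPGroupoid

/-! ## The principal groupoid of an action -/

/-- The orbit equivalence relation, as a Borel subset of `X × X`. -/
def OrbitRelation (G : Type u) (X : Type v) [Group G] [MulAction G X] : Type v :=
  {p : X × X // ∃ g : G, g • p.1 = p.2}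

instance (G : Type u) (X : Type v) [Group G] [MulAction G X] [MeasurableSpace X] :
    MeasurableSpace (OrbitRelation G X) :=
  inferInstanceAs (MeasurableSpace {p : X × X // ∃ g : G, g • p.1 = p.2})

instance (G : Type u) (X : Type v) [Group G] [Countable G] [MulAction G X] [MeasurableSpace X]
    [StandardBorelSpace X] [MeasurableConstSMul G X] : StandardBorelSpace (OrbitRelation G X) := by
  have h : MeasurableSet {p : X × X | ∃ g : G, g • p.1 = p.2} := by
    rw [ofPred_exists]
    exact .iUnion fun g => measurableSet_eq_fun (measurable_fst.const_smul g) measurable_snd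
  exact h.standardBorel

theorem lintegral_fibres {ι : Type u} [Countable ι] {H : Type v} {X : Type w} [MeasurableSpace H]
    [StandardBorelSpace H] [MeasurableSpace X] [StandardBorelSpace X] (μ : Measure X) (φ : H → X)
    (hφ : Measurable φ) (C : ι → Set H) (hC : ∀ i, MeasurableSet (C i))
    (hd : Pairwise (Function.onFun Disjoint C)) (hinj : ∀ i, InjOn φ (C i)) :
    ∫⁻ x, ((φ ⁻¹' {x} ∩ ⋃ i, C i).encard : ℝ≥0∞) ∂μ = ∑' i, μ (φ '' C i) := by
  have hm : ∀ i, MeasurableSet (φ '' C i) := fun i => (hC i).image_of_measurable_injOn hφ (hinj i)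
  have key : ∀ x, ((φ ⁻¹' {x} ∩ ⋃ i, C i).encard : ℝ≥0∞) =
      ∑' i, (φ '' C i).indicator (fun _ => 1) x := by
    intro x
    have hx : MeasurableSet (φ ⁻¹' {x}) := hφ (measurableSet_singleton x)
    rw [← Measure.count_apply (hx.inter (.iUnion hC)), inter_iUnion, measure_iUnion
      (fun i j h => (hd h).mono inter_subset_right inter_subset_right) (fun i => hx.inter (hC i))]
    refine tsum_congr fun i => ?_
    by_cases h : x ∈ φ '' C i
    · obtain ⟨p, hp, rfl⟩ := h
      have : φ ⁻¹' {φ p} ∩ C i = {p} := by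
        ext q
        constructor
        · rintro ⟨hq, hq'⟩
          exact hinj i hq' hp hq
        · rintro rfl
          exact ⟨rfl, hp⟩
      rw [this, Measure.count_singleton, indicator_of_mem (mem_image_of_mem φ hp)]
    · have : φ ⁻¹' {x} ∩ C i = ∅ := by
        ext q
        simp only [mem_inter_iff, mem_preimage, mem_singleton_iff, mem_empty_iff_false, iff_false]
        rintro ⟨hq, hq'⟩
        exact h ⟨q, hq', hq⟩
      rw [this, measure_empty, indicator_of_notMem h]
  simp_rw [key]
  rw [lintegral_tsum fun i => (measurable_const.indicator (hm i)).aemeasurable]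
  refine tsum_congr fun i => ?_
  rw [lintegral_indicator_const (hm i), one_mul]

section Principal

variable (G : Type u) (X : Type v) [Group G] [Countable G] [MulAction G X] [MeasurableSpace X]
  [StandardBorelSpace X] [MeasurableConstSMul G X]

theorem lintegral_orbit_fibres (μ : Measure X) (hμ : ∀ g : G, MeasurePreserving (g • · : X → X) μ μ)
    (B : Set (OrbitRelation G X)) (hB : MeasurableSet B) :
    ∫⁻ x, (((fun p : OrbitRelation G X => p.1.2) ⁻¹' {x} ∩ B).encard : ℝ≥0∞) ∂μ =
      ∫⁻ x, (((fun p : OrbitRelation G X => p.1.1) ⁻¹' {x} ∩ B).encard : ℝ≥0∞) ∂μ := by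
  obtain ⟨f, hf⟩ := exists_injective_nat G
  have hs : Measurable fun p : OrbitRelation G X => p.1.2 :=
    measurable_snd.comp measurable_subtype_coe
  have hr : Measurable fun p : OrbitRelation G X => p.1.1 :=
    measurable_fst.comp measurable_subtype_coe
  let E : G → Set (OrbitRelation G X) := fun g => {p | g • p.1.1 = p.1.2}
  have hE : ∀ g, MeasurableSet (E g) := fun g => measurableSet_eq_fun (hr.const_smul g) hs
  let C : G → Set (OrbitRelation G X) := fun g =>
    B ∩ (E g ∩ ⋂ k : G, {p | f k < f g → p ∉ E k})
  have hC : ∀ g, MeasurableSet (C g) := fun g =>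
    hB.inter ((hE g).inter (.iInter fun k => (MeasurableSet.const _).imp (hE k).compl))
  have hCE : ∀ g, ∀ p ∈ C g, g • p.1.1 = p.1.2 := fun g p hp => hp.2.1
  have hU : B = ⋃ g, C g := by
    ext p
    simp only [mem_iUnion]
    constructor
    · intro hp
      classical
      have hex : ∃ n, ∃ g, f g = n ∧ p ∈ E g := by
        obtain ⟨g, hg⟩ := p.2
        exact ⟨f g, g, rfl, hg⟩
      obtain ⟨g, hg, hpg⟩ := Nat.find_spec hex
      refine ⟨g, hp, hpg, mem_iInter.2 fun k hk hpk => ?_⟩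
      rw [hg] at hk
      exact Nat.find_min hex hk ⟨k, rfl, hpk⟩
    · rintro ⟨g, hp⟩
      exact hp.1
  have hd : Pairwise (Function.onFun Disjoint C) := by
    intro g k hgk
    refine disjoint_left.2 fun p hp hp' => ?_
    rcases lt_trichotomy (f g) (f k) with h | h | h
    · exact mem_iInter.1 hp'.2.2 g h hp.2.1
    · exact hgk (hf h)
    · exact mem_iInter.1 hp.2.2 k h hp'.2.1
  rw [hU, lintegral_fibres μ _ hs C hC hd, lintegral_fibres μ _ hr C hC hd]
  · refine tsum_congr fun g => ?_
    have hinj : InjOn (fun p : OrbitRelation G X => p.1.2) (C g) := by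
      intro p hp q hq (h : p.1.2 = q.1.2)
      refine Subtype.ext (Prod.ext ?_ h)
      rw [← hCE g p hp, ← hCE g q hq] at h
      exact MulAction.injective g h
    rw [← (hμ g).measure_preimage
      ((hC g).image_of_measurable_injOn hs hinj).nullMeasurableSet]
    congr 1
    ext x
    constructor
    · rintro ⟨p, hp, h⟩
      refine ⟨p, hp, MulAction.injective g ?_⟩
      exact (hCE g p hp).trans h
    · rintro ⟨p, hp, rfl⟩
      exact ⟨p, hp, (hCE g p hp).symm⟩
  · intro g p hp q hq (h : p.1.1 = q.1.1)
    refine Subtype.ext (Prod.ext h ?_)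
    rw [← hCE g p hp, ← hCE g q hq, h]
  · intro g p hp q hq (h : p.1.2 = q.1.2)
    refine Subtype.ext (Prod.ext ?_ h)
    rw [← hCE g p hp, ← hCE g q hq] at h
    exact MulAction.injective g h


/-- The principal groupoid of a pmp action `G ↷ (X, μ)`: morphisms are the pairs `(x, y)` in one
orbit, the object `x` is identified with the unit `(x, x)`, the source of `(x, y)` is `y`, its range
is `x`, and `(x, y)(y, z) = (x, z)`. -/
def principalGroupoid (μ : Measure X) [IsProbabilityMeasure μ]
    (hμ : ∀ g : G, MeasurePreserving (g • · : X → X) μ μ) :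
    PMPGroupoid X (OrbitRelation G X) where
  src p := p.1.2
  rng p := p.1.1
  unit x := ⟨(x, x), 1, one_smul G x⟩
  inv p := ⟨(p.1.2, p.1.1), p.2.imp' (fun g => g⁻¹) fun g hg => inv_smul_eq_iff.2 hg.symm⟩
  comp p q h := ⟨(p.1.1, q.1.2), by
    obtain ⟨⟨x, y⟩, g, hg⟩ := p
    obtain ⟨⟨y', z⟩, k, hk⟩ := q
    exact ⟨k * g, by simp_all [mul_smul]⟩⟩
  src_unit _ := rfl
  rng_unit _ := rfl
  src_comp _ _ _ := rfl
  rng_comp _ _ _ := rfl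
  comp_assoc _ _ _ _ _ := rfl
  comp_unit _ := rfl
  unit_comp _ := rfl
  src_inv _ := rfl
  rng_inv _ := rfl
  inv_comp _ := rfl
  comp_inv _ := rfl
  measurable_src := measurable_snd.comp measurable_subtype_coe
  measurable_rng := measurable_fst.comp measurable_subtype_coe
  measurable_unit := (measurable_id.prodMk measurable_id).subtype_mk
  measurable_inv := ((measurable_snd.comp measurable_subtype_coe).prodMk
    (measurable_fst.comp measurable_subtype_coe)).subtype_mk
  measurable_comp := by
    refine Measurable.subtype_mk (Measurable.prodMk ?_ ?_)
    · exact measurable_fst.comp (measurable_subtype_coe.comp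
        (measurable_fst.comp measurable_subtype_coe))
    · exact measurable_snd.comp (measurable_subtype_coe.comp
        (measurable_snd.comp measurable_subtype_coe))
  countable_src y := by
    refine (countable_range fun g : G =>
      (⟨(g • y, y), g⁻¹, inv_smul_smul g y⟩ : OrbitRelation G X)).mono ?_
    rintro ⟨⟨x, y'⟩, g, hg⟩ (rfl : y' = y)
    exact ⟨g⁻¹, Subtype.ext (Prod.ext (inv_smul_eq_iff.2 hg.symm) rfl)⟩
  countable_rng x := by
    refine (countable_range fun g : G => (⟨(x, g • x), g, rfl⟩ : OrbitRelation G X)).mono ?_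
    rintro ⟨⟨x', y⟩, g, hg⟩ (rfl : x' = x)
    exact ⟨g, Subtype.ext (Prod.ext rfl hg)⟩
  ν := μ
  isProbabilityMeasure := inferInstance
  pmp := lintegral_orbit_fibres G X μ hμ

end Principal

/-! ## Invariant random subgroups -/

section Subgroups

variable {G : Type u} [Group G]

open Classical in
/-- A subgroup as a point of `2^G`, where `2^G` is `G → Bool` with the product topology. -/
def toCantor (K : Subgroup G) : G → Bool := fun g => decide (g ∈ K)

/-- `Sub_G` has the topology of a subspace of `2^G`. -/
instance : TopologicalSpace (Subgroup G) := .induced toCantor inferInstance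

/-- The Borel sigma-algebra of `Sub_G`. -/
instance : MeasurableSpace (Subgroup G) := .comap toCantor inferInstance

instance [Countable G] : BorelSpace (Subgroup G) where
  measurable_eq := by
    change MeasurableSpace.comap toCantor MeasurableSpace.pi = _
    rw [BorelSpace.measurable_eq (α := G → Bool), ← borel_comap]

theorem measurable_toCantor : Measurable (toCantor : Subgroup G → G → Bool) :=
  comap_measurable _

theorem measurableSet_mem (g : G) : MeasurableSet {K : Subgroup G | g ∈ K} := by
  have h : MeasurableSet {b : G → Bool | b g = true} :=
    (measurable_pi_apply (X := fun _ : G => Bool) g) (measurableSet_singleton true)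
  convert measurable_toCantor h using 1
  ext K
  simp [toCantor]

/-- The conjugate `g K g⁻¹`. -/
def conjSubgroup (g : G) (K : Subgroup G) : Subgroup G := K.map (MulAut.conj g).toMonoidHom

theorem mem_conjSubgroup {g x : G} {K : Subgroup G} :
    x ∈ conjSubgroup g K ↔ g⁻¹ * x * g ∈ K := by
  constructor
  · rintro ⟨y, hy, rfl⟩
    simpa [mul_assoc] using hy
  · intro h
    exact ⟨_, h, by simp [mul_assoc]⟩

/-- Invariance of a measure on `Sub_G` under conjugation. -/
def IsConjInvariant (η : Measure (Subgroup G)) : Prop :=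
  ∀ g : G, MeasurePreserving (conjSubgroup g) η η

/-- The uniform probability measure on `d` points. -/
def uniformLaw (d : ℕ) [NeZero d] : ProbabilityMeasure (Fin d) :=
  ⟨ProbabilityTheory.uniformOn univ, inferInstance⟩

/-- `Stab_σ(q) = {g | σ(g) q = q}`, as a point of `2^G`. -/
def approxStab {d : ℕ} (σ : G → Equiv.Perm (Fin d)) (q : Fin d) : G → Bool :=
  fun g => decide (σ g q = q)

/-- A Borel probability measure `η` on `Sub_G` is sofic. Since `Stab_σ(q)` need not be a subgroup,
`η` is regarded as a Borel probability measure on `2^G`, and neighbourhoods are taken in the weak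
topology of the space of Borel probability measures on `2^G`. -/
def IsSoficIRS [Countable G] (η : Measure (Subgroup G)) [IsProbabilityMeasure η] : Prop :=
  ∀ (δ : ℝ), 0 < δ → ∀ (K : Finset G) (Ω : Set (ProbabilityMeasure (G → Bool))), IsOpen Ω →
    ProbabilityMeasure.map (⟨η, inferInstance⟩ : ProbabilityMeasure (Subgroup G))
      (f := toCantor) measurable_toCantor.aemeasurable ∈ Ω →
    ∃ (d : ℕ) (_ : NeZero d) (σ : G → Equiv.Perm (Fin d)),
      (∀ g ∈ K, ∀ h ∈ K,
        1 - δ ≤ ({q : Fin d | σ g (σ h q) = σ (g * h) q}.ncard : ℝ) / d) ∧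
      ProbabilityMeasure.map (uniformLaw d) (f := approxStab σ)
        (measurable_of_countable _).aemeasurable ∈ Ω

end Subgroups

/-! ## Non-free Bernoulli shifts -/

/-- `Sub_G ⊗ Z`: pairs `(K, ω)` with `K` a subgroup of `G` and `ω : G/K → Z`. -/
def SubTensor (G : Type u) (Z : Type v) [Group G] : Type (max u v) :=
  Σ K : Subgroup G, (G ⧸ K → Z)

namespace SubTensor

variable {G : Type u} {Z : Type v} [Group G]

/-- The embedding `(K, ω) ↦ (K, g ↦ ω(gK))` into `Sub_G × Z^G`. -/
def embed (x : SubTensor G Z) : Subgroup G × (G → Z) := (x.1, fun g => x.2 (g : G ⧸ x.1))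

theorem embed_injective : Function.Injective (embed : SubTensor G Z → _) := by
  rintro ⟨K, ω⟩ ⟨K', ω'⟩ h
  obtain ⟨rfl, h2⟩ := Prod.mk.inj h
  congr 1
  funext c
  induction c using QuotientGroup.induction_on with
  | H g => exact congrFun h2 g

/-- The Borel structure induced by `embed`. -/
instance [MeasurableSpace Z] : MeasurableSpace (SubTensor G Z) := .comap embed inferInstance

/-- The map `G/gKg⁻¹ → G/K` sending `f gKg⁻¹` to `f g K`. -/
def cosetShift (g : G) (K : Subgroup G) : G ⧸ conjSubgroup g K → G ⧸ K :=
  Quotient.map' (fun f => f * g) fun a b h => by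
    rw [QuotientGroup.leftRel_apply, mem_conjSubgroup] at h
    rw [QuotientGroup.leftRel_apply]
    simpa [mul_assoc] using h

/-- `g(K, ω) = (gKg⁻¹, gω)` with `gω(f gKg⁻¹) = ω(f g K)`. -/
instance : SMul G (SubTensor G Z) where
  smul g x := ⟨conjSubgroup g x.1, fun c => x.2 (cosetShift g x.1 c)⟩

theorem embed_smul (g : G) (x : SubTensor G Z) :
    embed (g • x) = (conjSubgroup g (embed x).1, fun f => (embed x).2 (f * g)) := rfl

instance : MulAction G (SubTensor G Z) where
  one_smul x := embed_injective <| by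
    rw [embed_smul]
    refine Prod.ext ?_ (by simp)
    ext y
    simp [mem_conjSubgroup]
  mul_smul g h x := embed_injective <| by
    simp only [embed_smul]
    refine Prod.ext ?_ (by simp [mul_assoc])
    ext y
    simp [mem_conjSubgroup, mul_assoc]

end SubTensor

theorem measurable_conjSubgroup {G : Type u} [Group G] (g : G) :
    Measurable (conjSubgroup g : Subgroup G → Subgroup G) := by
  refine measurable_comap_iff.2 (measurable_pi_iff.2 fun x => ?_)
  refine measurable_to_bool ?_
  convert measurableSet_mem (g⁻¹ * x * g) using 1
  ext K
  simp [toCantor, mem_conjSubgroup]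

theorem standardBorelSpace_comap {α : Type u} {β : Type v} [MeasurableSpace β]
    [StandardBorelSpace β] (e : α → β) (he : Function.Injective e)
    (hr : MeasurableSet (range e)) :
    @StandardBorelSpace α (MeasurableSpace.comap e inferInstance) := by
  obtain ⟨t, hb, hp⟩ := hr.standardBorel.polish
  let f : α ≃ range e := Equiv.ofInjective e he
  refine @StandardBorelSpace.mk _ (_) ⟨t.induced f, ?_, f.polishSpace_induced⟩
  refine @BorelSpace.mk _ (_) (_) ?_
  have h : MeasurableSpace.comap e inferInstance =
      MeasurableSpace.comap f (inferInstance : MeasurableSpace (range e)) := by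
    change _ = MeasurableSpace.comap f (MeasurableSpace.comap Subtype.val _)
    rw [MeasurableSpace.comap_comp]
    rfl
  rw [h, hb.measurable_eq]
  exact (borel_comap (f := f)).symm

instance {G : Type u} [Group G] [Countable G] : StandardBorelSpace (Subgroup G) := by
  refine standardBorelSpace_comap toCantor ?_ ?_
  · intro K K' h
    ext g
    simpa [toCantor] using congrFun h g
  · have : range (toCantor : Subgroup G → G → Bool) =
        {b | b 1 = true} ∩ ((⋂ g, ⋂ h, {b | b g = true → b h = true → b (g * h) = true}) ∩
          ⋂ g, {b | b g = true → b g⁻¹ = true}) := by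
      ext b
      simp only [mem_range, mem_inter_iff, mem_ofPred_eq, mem_iInter]
      constructor
      · rintro ⟨K, rfl⟩
        simp only [toCantor, decide_eq_true_eq]
        exact ⟨K.one_mem, fun _ _ => K.mul_mem, fun _ => K.inv_mem⟩
      · rintro ⟨h1, h2, h3⟩
        exact ⟨{ carrier := {g | b g = true}, one_mem' := h1, mul_mem' := fun {x y} => h2 x y,
                 inv_mem' := fun {x} => h3 x }, by ext g; simp [toCantor]⟩
    rw [this]
    have hm : ∀ g : G, MeasurableSet {b : G → Bool | b g = true} := fun g =>
      (measurable_pi_apply (X := fun _ : G => Bool) g) (measurableSet_singleton true)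
    exact (hm 1).inter ((MeasurableSet.iInter fun g => .iInter fun h =>
      (hm g).imp ((hm h).imp (hm _))).inter (.iInter fun g => (hm g).imp (hm _)))

/-- The inclusion of `Z^{G/K}` as the fibre of `Sub_G ⊗ Z` over `K`. -/
def SubTensor.mk {G : Type u} {Z : Type v} [Group G] (K : Subgroup G) (ω : G ⧸ K → Z) : SubTensor G Z := ⟨K, ω⟩

theorem measurable_mk {G : Type u} {Z : Type v} [Group G] [MeasurableSpace Z] (K : Subgroup G) :
    Measurable (SubTensor.mk K : (G ⧸ K → Z) → SubTensor G Z) := by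
  refine measurable_comap_iff.2 (measurable_const.prodMk (measurable_pi_iff.2 fun g => ?_))
  exact measurable_pi_apply (X := fun _ : G ⧸ K => Z) (g : G ⧸ K)

section Bernoulli

variable {G : Type u} {Z : Type v} [Group G] [Countable G] [MeasurableSpace Z]

namespace SubTensor

instance : MeasurableConstSMul G (SubTensor G Z) where
  measurable_const_smul g := by
    have he : Measurable (embed : SubTensor G Z → _) := comap_measurable _
    refine measurable_comap_iff.2 ?_
    exact ((measurable_conjSubgroup g).comp (measurable_fst.comp he)).prodMk
      (measurable_pi_iff.2 fun f => (measurable_pi_apply (f * g)).comp (measurable_snd.comp he))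

instance [StandardBorelSpace Z] : StandardBorelSpace (SubTensor G Z) := by
  refine standardBorelSpace_comap embed embed_injective ?_
  have : range (embed : SubTensor G Z → _) =
      ⋂ g : G, ⋂ h : G, {p | h ∈ p.1 → p.2 (g * h) = p.2 g} := by
    ext ⟨K, w⟩
    simp only [mem_range, mem_ofPred_eq, mem_iInter]
    constructor
    · rintro ⟨x, hx⟩ g h hh
      obtain ⟨rfl, rfl⟩ := Prod.mk.inj hx
      exact congrArg x.2 (by simpa [QuotientGroup.eq] using hh)
    · intro hw
      refine ⟨⟨K, fun c => Quotient.liftOn' c w fun a b hab => ?_⟩, rfl⟩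
      rw [QuotientGroup.leftRel_apply] at hab
      simpa using (hw a _ hab).symm
  rw [this]
  refine .iInter fun g => .iInter fun h => MeasurableSet.imp ?_ ?_
  · exact measurable_fst (measurableSet_mem h)
  · exact measurableSet_eq_fun ((measurable_pi_apply _).comp measurable_snd)
      ((measurable_pi_apply _).comp measurable_snd)

end SubTensor

/-- The product measure `ζ^{G/K}`, placed on the fibre of `Sub_G ⊗ Z` over `K`. -/
def fibreMeasure (ζ : Measure Z) [IsProbabilityMeasure ζ] (K : Subgroup G) :
    Measure (SubTensor G Z) :=
  (Measure.infinitePi fun _ : G ⧸ K => ζ).map (SubTensor.mk K)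

/-- The measure `η ⊗ ζ`, given by `d(η ⊗ ζ)(K, ω) = dζ^{G/K}(ω) dη(K)`. -/
def tensorMeasure (η : Measure (Subgroup G)) (ζ : Measure Z) [IsProbabilityMeasure ζ] :
    Measure (SubTensor G Z) :=
  η.bind (fibreMeasure ζ)

instance (ζ : Measure Z) [IsProbabilityMeasure ζ] (K : Subgroup G) :
    IsProbabilityMeasure (fibreMeasure ζ K) :=
  Measure.isProbabilityMeasure_map (measurable_mk K).aemeasurable

theorem measurable_relabel {α : Type u} {β : Type w} (r : α → β) :
    Measurable fun (w : β → Z) (a : α) => w (r a) :=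
  measurable_pi_iff.2 fun a => measurable_pi_apply (r a)

/-- Relabelling an i.i.d. family along an injection gives an i.i.d. family. -/
theorem map_infinitePi_comp {α : Type u} {β : Type w} (ζ : Measure Z) [IsProbabilityMeasure ζ]
    (r : α → β) (hr : Function.Injective r) :
    (Measure.infinitePi fun _ : β => ζ).map (fun w a => w (r a)) =
      Measure.infinitePi fun _ : α => ζ := by
  classical
  refine Measure.eq_infinitePi _ fun s t ht => ?_
  rw [Measure.map_apply (measurable_relabel r) (.pi s.countable_toSet fun i _ => ht i)]
  rcases isEmpty_or_nonempty α with hα | hα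
  · have : s = ∅ := Finset.eq_empty_of_isEmpty s
    subst this
    simp
  have hinv : ∀ a, Function.invFun r (r a) = a := Function.leftInverse_invFun hr
  have : (fun (w : β → Z) (a : α) => w (r a)) ⁻¹' (s : Set α).pi t =
      ((s.image r : Finset β) : Set β).pi fun b => t (Function.invFun r b) := by
    ext w
    simp [Set.mem_pi, hinv]
  rw [this, Measure.infinitePi_pi _ fun b _ => ht _, Finset.prod_image fun a _ b _ h => hr h]
  simp [hinv]

theorem measurable_fibreMeasure (ζ : Measure Z) [IsProbabilityMeasure ζ] :
    Measurable (fibreMeasure ζ : Subgroup G → Measure (SubTensor G Z)) := by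
  classical
  obtain ⟨f, hf⟩ := exists_injective_nat G
  have hex : ∀ (K : Subgroup G) (g : G), ∃ n, ∃ k : G, f k = n ∧ g⁻¹ * k ∈ K :=
    fun K g => ⟨f g, g, rfl, by simp⟩
  -- the first element of the coset `gK`
  let rep : Subgroup G → G → G := fun K g => (Nat.find_spec (hex K g)).choose
  have hrep1 : ∀ K g, f (rep K g) = Nat.find (hex K g) :=
    fun K g => (Nat.find_spec (hex K g)).choose_spec.1
  have hrep2 : ∀ K g, g⁻¹ * rep K g ∈ K := fun K g => (Nat.find_spec (hex K g)).choose_spec.2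
  have hrep_iff : ∀ K g k, rep K g = k ↔ g⁻¹ * k ∈ K ∧ ∀ l, f l < f k → g⁻¹ * l ∉ K := by
    intro K g k
    constructor
    · rintro rfl
      refine ⟨hrep2 K g, fun l hl hl' => ?_⟩
      rw [hrep1] at hl
      exact Nat.find_min (hex K g) hl ⟨l, rfl, hl'⟩
    · rintro ⟨h1, h2⟩
      apply hf
      rw [hrep1]
      refine le_antisymm (Nat.find_min' _ ⟨k, rfl, h1⟩) ?_
      by_contra! h
      rw [← hrep1] at h
      exact h2 _ h (hrep2 K g)
  have hrep_congr : ∀ K (g h : G), g⁻¹ * h ∈ K → rep K g = rep K h := by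
    intro K g h hgh
    have e : ∀ l, g⁻¹ * l ∈ K ↔ h⁻¹ * l ∈ K := fun l => by
      have : g⁻¹ * l = (g⁻¹ * h) * (h⁻¹ * l) := by group
      rw [this, K.mul_mem_cancel_left hgh]
    rw [hrep_iff]
    simp only [e]
    exact (hrep_iff K h _).1 rfl
  let R : ∀ K : Subgroup G, G ⧸ K → G := fun K c => Quotient.liftOn' c (rep K) fun a b h =>
    hrep_congr K a b (QuotientGroup.leftRel_apply.1 h)
  have hR : ∀ K, Function.Injective (R K) := by
    intro K c c' h
    induction c using QuotientGroup.induction_on with | H a => ?_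
    induction c' using QuotientGroup.induction_on with | H b => ?_
    have h' : rep K a = rep K b := h
    rw [QuotientGroup.eq]
    have h1 := hrep2 K a
    rw [h'] at h1
    have := K.mul_mem h1 (K.inv_mem (hrep2 K b))
    simpa using this
  let Φ : Subgroup G × (G → Z) → SubTensor G Z := fun p => SubTensor.mk p.1 fun c => p.2 (R p.1 c)
  have hΦ : Measurable Φ := by
    refine measurable_comap_iff.2 (measurable_fst.prodMk (measurable_pi_iff.2 fun g => ?_))
    intro S hS
    have : (fun p : Subgroup G × (G → Z) => p.2 (rep p.1 g)) ⁻¹' S =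
        ⋃ k : G, ({p | rep p.1 g = k} ∩ {p | p.2 k ∈ S}) := by
      ext p
      simp
    change MeasurableSet ((fun p : Subgroup G × (G → Z) => p.2 (rep p.1 g)) ⁻¹' S)
    rw [this]
    refine .iUnion fun k => MeasurableSet.inter ?_ ?_
    · simp only [hrep_iff]
      refine measurable_fst (t := {K : Subgroup G | g⁻¹ * k ∈ K ∧
        ∀ l, f l < f k → g⁻¹ * l ∉ K}) ?_
      have : {K : Subgroup G | g⁻¹ * k ∈ K ∧ ∀ l, f l < f k → g⁻¹ * l ∉ K} =
          {K : Subgroup G | g⁻¹ * k ∈ K} ∩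
            ⋂ l, {K : Subgroup G | f l < f k → K ∉ {K : Subgroup G | g⁻¹ * l ∈ K}} := by
        ext K
        simp
      rw [this]
      exact (measurableSet_mem _).inter
        (.iInter fun l => (MeasurableSet.const _).imp (measurableSet_mem _).compl)
    · exact ((measurable_pi_apply (X := fun _ : G => Z) k).comp measurable_snd) hS
  have hfib : ∀ K, fibreMeasure ζ K =
      (Measure.infinitePi fun _ : G => ζ).map fun w => Φ (K, w) := by
    intro K
    rw [fibreMeasure, ← map_infinitePi_comp ζ (R K) (hR K), Measure.map_map (measurable_mk K)
      (measurable_relabel (R K))]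
    rfl
  refine Measure.measurable_of_measurable_coe _ fun A hA => ?_
  have : ∀ K, fibreMeasure ζ K A =
      (Measure.infinitePi fun _ : G => ζ) (Prod.mk K ⁻¹' (Φ ⁻¹' A)) := by
    intro K
    have hm : Measurable fun w => Φ (K, w) := hΦ.comp measurable_prodMk_left
    rw [hfib, Measure.map_apply hm hA]
    rfl
  simp only [this]
  exact measurable_measure_prodMk_left (hΦ hA)

theorem tensorMeasure_apply (η : Measure (Subgroup G)) (ζ : Measure Z) [IsProbabilityMeasure ζ]
    {A : Set (SubTensor G Z)} (hA : MeasurableSet A) :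
    tensorMeasure η ζ A = ∫⁻ K, fibreMeasure ζ K A ∂η :=
  Measure.bind_apply hA (measurable_fibreMeasure ζ).aemeasurable

instance (η : Measure (Subgroup G)) [IsProbabilityMeasure η] (ζ : Measure Z)
    [IsProbabilityMeasure ζ] : IsProbabilityMeasure (tensorMeasure η ζ) :=
  ⟨by rw [tensorMeasure_apply η ζ .univ]; simp⟩

theorem map_smul_fibreMeasure (ζ : Measure Z) [IsProbabilityMeasure ζ] (g : G) (K : Subgroup G) :
    (fibreMeasure ζ K).map (g • ·) = fibreMeasure ζ (conjSubgroup g K) := by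
  have hinj : Function.Injective (SubTensor.cosetShift g K) := by
    intro c c' h
    induction c using QuotientGroup.induction_on with | H a => ?_
    induction c' using QuotientGroup.induction_on with | H b => ?_
    have h' : ((a * g : G) : G ⧸ K) = ((b * g : G) : G ⧸ K) := h
    rw [QuotientGroup.eq] at h'
    rw [QuotientGroup.eq, mem_conjSubgroup]
    simpa [mul_assoc] using h'
  rw [fibreMeasure, fibreMeasure, ← map_infinitePi_comp ζ _ hinj,
    Measure.map_map (measurable_const_smul g) (measurable_mk K),
    Measure.map_map (measurable_mk _) (measurable_relabel _)]
  rfl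

theorem measurePreserving_smul_tensorMeasure (η : Measure (Subgroup G)) (hη : IsConjInvariant η)
    (ζ : Measure Z) [IsProbabilityMeasure ζ] (g : G) :
    MeasurePreserving (g • · : SubTensor G Z → SubTensor G Z) (tensorMeasure η ζ)
      (tensorMeasure η ζ) := by
  refine ⟨measurable_const_smul g, ?_⟩
  ext A hA
  rw [Measure.map_apply (measurable_const_smul g) hA,
    tensorMeasure_apply η ζ (measurable_const_smul g hA), tensorMeasure_apply η ζ hA,
    ← (hη g).lintegral_comp (f := fun K => fibreMeasure ζ K A)
      ((Measure.measurable_coe hA).comp (measurable_fibreMeasure ζ))]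
  refine lintegral_congr fun K => ?_
  rw [← Measure.map_apply (measurable_const_smul g) hA, map_smul_fibreMeasure]

end Bernoulli

end SoficGroupoid

end

noncomputable section

namespace SoficGroupoid

/-! ## Local events and codes -/

/-! Almost every point `x = (L, ω)` has stabilizer exactly `L`: since `ζ` has no atoms, the labels
at two distinct cosets almost surely differ (`ae_stabilizer`). Hence whether `g • x = h • x` can be
read off the configuration of `x` in `2^G × Z^G`, by testing `g⁻¹ * h ∈ L`.

A partial automorphism sends `x` to some `g • x`. Up to small measure, this `g` is given by a code:
it has finitely many values, each taken on an event with finitely many coordinates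
(`exists_code_approx`). A code also runs on any finite set with permutations `σ g` and labels `z`: a
point reads its own configuration, obtains `g`, and moves by `σ g`. Products, inverses and fixed
points of codes are governed by local events (`mismatch`, `fixedEvent`). Where `σ` respects finitely
many products, `exists_modelMap_bind` turns the absence of a mismatch into an identity between
partial maps. It is therefore enough to find models in which finitely many local events have nearly
their `η ⊗ ζ` probability as frequency.

For i.i.d. labels, the probability of a local event at a good point of a model is `localProb` of its
approximate stabilizer. This is a continuous function on `2^G`, and its `η`-integral is the `η ⊗ ζ`
probability of the event. Soficity of `η`, being weak approximation, thus gives the right expected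
frequencies (`exists_sofic_model`). Disjoint copies with independent labels and the law of large
numbers replace expectations by the frequencies of one fixed labelling, and make `d` large
(`exists_labelled_model`).

The partial map of a model need not be injective, so `s` is sent to the pairs matched by its code in
one direction and by a code of its inverse in the other (`FinPartialAut.ofMaps`); few arrows are
lost. Codes are chosen once per class modulo null sets, so partial automorphisms that agree almost
everywhere have equal images. Dirac masses at these maps form the sofic approximation
(`isSofic_of_exists_map`). -/

/-- A point of `2^G × Z^G`. -/
abbrev Config (G : Type u) (Z : Type v) := G → Bool × Z

section Local

variable {G : Type u} {Z : Type v} [MeasurableSpace Z]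

/-- An event that depends on finitely many coordinates. -/
structure IsLocal (C : Set (Config G Z)) : Prop where
  measurableSet : MeasurableSet C
  exists_window : ∃ T : Finset G, ∀ w w' : Config G Z, (∀ f ∈ T, w f = w' f) → w ∈ C → w' ∈ C

theorem IsLocal.empty : IsLocal (∅ : Set (Config G Z)) := ⟨.empty, ∅, fun _ _ _ h => h⟩

theorem IsLocal.compl {C : Set (Config G Z)} (hC : IsLocal C) : IsLocal Cᶜ := by
  obtain ⟨hm, T, hT⟩ := hC
  exact ⟨hm.compl, T, fun w w' h hw hw' => hw (hT w' w (fun f hf => (h f hf).symm) hw')⟩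

theorem IsLocal.inter {C D : Set (Config G Z)} (hC : IsLocal C) (hD : IsLocal D) :
    IsLocal (C ∩ D) := by
  classical
  obtain ⟨hm, T, hT⟩ := hC
  obtain ⟨hm', T', hT'⟩ := hD
  refine ⟨hm.inter hm', T ∪ T', fun w w' h hw => ⟨hT w w' (fun f hf => h f ?_) hw.1,
    hT' w w' (fun f hf => h f ?_) hw.2⟩⟩ <;> simp [hf]

theorem IsLocal.union {C D : Set (Config G Z)} (hC : IsLocal C) (hD : IsLocal D) :
    IsLocal (C ∪ D) := by
  have := (hC.compl.inter hD.compl).compl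
  rwa [compl_inter, compl_compl, compl_compl] at this

theorem IsLocal.univ : IsLocal (Set.univ : Set (Config G Z)) := by
  simpa using (IsLocal.empty (G := G) (Z := Z)).compl

theorem IsLocal.const (p : Prop) : IsLocal {_w : Config G Z | p} := by
  by_cases h : p
  · simpa [h] using IsLocal.univ
  · simpa [h] using IsLocal.empty

theorem IsLocal.biUnion {ι : Type*} (s : Finset ι) {C : ι → Set (Config G Z)}
    (hC : ∀ i ∈ s, IsLocal (C i)) : IsLocal (⋃ i ∈ s, C i) := by
  classical
  induction s using Finset.induction_on with
  | empty => simpa using IsLocal.empty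
  | insert a s ha ih =>
    rw [Finset.set_biUnion_insert]
    exact (hC a (by simp)).union (ih fun i hi => hC i (by simp [hi]))

theorem IsLocal.coordinate (g : G) {S : Set (Bool × Z)} (hS : MeasurableSet S) :
    IsLocal {w : Config G Z | w g ∈ S} :=
  ⟨measurable_pi_apply (X := fun _ : G => Bool × Z) g hS, {g}, fun w w' h hw => by
    have := h g (by simp)
    simpa [← this] using hw⟩

theorem IsLocal.stab (g : G) : IsLocal {w : Config G Z | (w g).1 = true} :=
  IsLocal.coordinate g (S := {p | p.1 = true}) (measurable_fst (measurableSet_singleton true))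

theorem generateFrom_isLocal :
    MeasurableSpace.generateFrom {C : Set (Config G Z) | IsLocal C} = MeasurableSpace.pi := by
  refine le_antisymm (MeasurableSpace.generateFrom_le fun C hC => hC.measurableSet) ?_
  refine iSup_le fun g => ?_
  rintro _ ⟨S, hS, rfl⟩
  exact MeasurableSpace.measurableSet_generateFrom (IsLocal.coordinate g hS)

theorem isSetAlgebra_isLocal : IsSetAlgebra {C : Set (Config G Z) | IsLocal C} where
  empty_mem := IsLocal.empty
  compl_mem _ h := h.compl
  union_mem _ _ h h' := h.union h'

/-- A function with finitely many values, each taken on a local event. -/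
structure IsCode (c : Config G Z → Option G) : Prop where
  finite : (range c).Finite
  fibre : ∀ o, IsLocal {w | c w = o}

/-- Only finitely many values occur, so the event splits into finitely many local pieces. Events
about composed codes are shown to be local by iterating this. -/
theorem IsCode.local_bind {c : Config G Z → Option G} (hc : IsCode c)
    {P : Option G → Config G Z → Prop} (hP : ∀ o, IsLocal {w | P o w}) :
    IsLocal {w | P (c w) w} := by
  have : {w | P (c w) w} = ⋃ o ∈ hc.finite.toFinset, ({w | c w = o} ∩ {w | P o w}) := by
    ext w
    simp only [mem_ofPred_eq, Finite.mem_toFinset, mem_iUnion, mem_inter_iff, exists_prop]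
    exact ⟨fun h => ⟨c w, mem_range_self w, rfl, h⟩, fun ⟨o, _, h, h'⟩ => h ▸ h'⟩
  rw [this]
  exact .biUnion _ fun o _ => (hc.fibre o).inter (hP o)

theorem IsCode.exists_window {c : Config G Z → Option G} (hc : IsCode c) :
    ∃ T : Finset G, ∀ w w' : Config G Z, (∀ f ∈ T, w f = w' f) → c w = c w' := by
  classical
  choose T hT using fun o => (hc.fibre o).exists_window
  refine ⟨hc.finite.toFinset.biUnion T, fun w w' h => ?_⟩
  refine (hT (c w) w w' (fun f hf => h f ?_) rfl).symm
  exact Finset.mem_biUnion.2 ⟨c w, by simp, hf⟩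

theorem IsCode.exists_values {c : Config G Z → Option G} (hc : IsCode c) :
    ∃ K : Finset G, ∀ w g, c w = some g → g ∈ K := by
  classical
  refine ⟨Finset.eraseNone hc.finite.toFinset, fun w g h => ?_⟩
  rw [Finset.mem_eraseNone]
  simpa using ⟨w, h⟩

/-- The sets `B g` may overlap; the element inserted last takes priority. This merges separate
approximations of the sets where a partial automorphism acts by `g` into one function. -/
theorem exists_code_of_cover (K : Finset G) (B : G → Set (Config G Z))
    (hB : ∀ g ∈ K, IsLocal (B g)) :
    ∃ c : Config G Z → Option G, IsCode c ∧ (∀ w g, c w = some g → g ∈ K ∧ w ∈ B g) ∧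
      ∀ w, c w = none → ∀ g ∈ K, w ∉ B g := by
  classical
  induction K using Finset.induction_on with
  | empty =>
    refine ⟨fun _ => none, ⟨(finite_singleton none).subset (range_subset_iff.2 fun _ => rfl),
      fun o => .const _⟩, by simp, by simp⟩
  | insert a s ha ih =>
    obtain ⟨c, hc, h1, h2⟩ := ih fun g hg => hB g (by simp [hg])
    refine ⟨fun w => if w ∈ B a then some a else c w, ⟨?_, fun o => ?_⟩, fun w g h => ?_,
      fun w h g hg => ?_⟩
    · refine (hc.finite.insert (some a)).subset (range_subset_iff.2 fun w => ?_)
      by_cases hw : w ∈ B a <;> simp [hw]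
    · have : {w | (if w ∈ B a then some a else c w) = o} =
          (B a ∩ {_w | some a = o}) ∪ ((B a)ᶜ ∩ {w | c w = o}) := by
        ext w
        by_cases hw : w ∈ B a <;> simp [hw]
      rw [this]
      have := hB a (by simp)
      exact (this.inter (.const _)).union (this.compl.inter (hc.fibre o))
    · by_cases hw : w ∈ B a
      · simp only [hw, if_true, Option.some.injEq] at h
        subst h
        simp [hw]
      · simp only [hw, if_false] at h
        have := h1 w g h
        simp [this]
    · by_cases hw : w ∈ B a
      · simp [hw] at h
      · simp only [hw, if_false] at h
        rcases Finset.mem_insert.1 hg with rfl | hg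
        · exact hw
        · exact h2 w h g hg

/-- The code of the identity on the domain of `c`. -/
def domCode [Group G] (c : Config G Z → Option G) (w : Config G Z) : Option G :=
  (c w).map fun _ => 1

theorem IsCode.domCode [Group G] {c : Config G Z → Option G} (hc : IsCode c) :
    IsCode (domCode c) := by
  refine ⟨(hc.finite.image (Option.map fun _ => 1)).subset ?_, fun o => ?_⟩
  · rintro _ ⟨w, rfl⟩
    exact ⟨c w, mem_range_self w, rfl⟩
  · exact hc.local_bind (P := fun o' _ => o'.map (fun _ => (1 : G)) = o) fun o' => .const _

end Local

/-! ### The shift action, and relations between codes as local events. -/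

section Shift

variable {G : Type u} {Z : Type v} [Group G]

/-- The action of `G` on `2^G × Z^G` that extends the action on `Sub_G ⊗ Z`. -/
def Config.shift (g : G) (w : Config G Z) : Config G Z :=
  fun k => ((w (g⁻¹ * k * g)).1, (w (k * g)).2)

/-- Equality of two partially defined group elements modulo the stabilizer recorded by `w`. -/
def Config.Agrees (w : Config G Z) : Option G → Option G → Prop
  | none, none => True
  | some k, some k' => (w (k⁻¹ * k')).1 = true
  | _, _ => False

/-- The event that `c₁` followed by `c₂` differs from `c₃`. -/
def mismatch (c₁ c₂ c₃ : Config G Z → Option G) : Set (Config G Z) :=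
  {w | ¬ w.Agrees ((c₁ w).bind fun g => (c₂ (w.shift g)).map (· * g)) (c₃ w)}

/-- The event that `c` fixes the point. -/
def fixedEvent (c : Config G Z → Option G) : Set (Config G Z) :=
  {w | ∃ g, c w = some g ∧ (w g).1 = true}

variable [MeasurableSpace Z]

theorem IsLocal.shift {C : Set (Config G Z)} (hC : IsLocal C) (g : G) :
    IsLocal {w : Config G Z | w.shift g ∈ C} := by
  classical
  obtain ⟨hm, T, hT⟩ := hC
  constructor
  · have : Measurable (Config.shift g : Config G Z → Config G Z) :=
      measurable_pi_iff.2 fun k => (measurable_fst.comp (measurable_pi_apply _)).prodMk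
        (measurable_snd.comp (measurable_pi_apply _))
    exact this hm
  · refine ⟨T.image (fun k => g⁻¹ * k * g) ∪ T.image (· * g), fun w w' h => ?_⟩
    refine hT _ _ fun f hf => ?_
    have h1 := h (g⁻¹ * f * g) (Finset.mem_union_left _ (Finset.mem_image_of_mem _ hf))
    have h2 := h (f * g) (Finset.mem_union_right _ (Finset.mem_image_of_mem _ hf))
    simp [Config.shift, h1, h2]

theorem IsCode.shift {c : Config G Z → Option G} (hc : IsCode c) (g : G) :
    IsCode fun w => c (w.shift g) :=
  ⟨hc.finite.subset (range_subset_iff.2 fun _ => mem_range_self _),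
    fun o => (hc.fibre o).shift g⟩

theorem isLocal_agrees (o o' : Option G) : IsLocal {w : Config G Z | w.Agrees o o'} := by
  rcases o with _ | k <;> rcases o' with _ | k'
  · exact .const True
  · exact .const False
  · exact .const False
  · exact .stab _

/-- Once the finitely many values of the three codes are fixed, at most one stabilizer coordinate
remains to be read. -/
theorem isLocal_mismatch {c₁ c₂ c₃ : Config G Z → Option G} (h₁ : IsCode c₁) (h₂ : IsCode c₂)
    (h₃ : IsCode c₃) : IsLocal (mismatch c₁ c₂ c₃) := by
  refine h₁.local_bind (P := fun o₁ w =>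
    ¬ w.Agrees (o₁.bind fun g => (c₂ (w.shift g)).map (· * g)) (c₃ w)) fun o₁ => ?_
  refine h₃.local_bind (P := fun o₃ w =>
    ¬ w.Agrees (o₁.bind fun g => (c₂ (w.shift g)).map (· * g)) o₃) fun o₃ => ?_
  rcases o₁ with _ | g
  · exact (isLocal_agrees none o₃).compl
  · exact (h₂.shift g).local_bind (P := fun o₂ w => ¬ w.Agrees (o₂.map (· * g)) o₃)
      fun o₂ => (isLocal_agrees _ o₃).compl

theorem isLocal_fixedEvent {c : Config G Z → Option G} (hc : IsCode c) :
    IsLocal (fixedEvent c) := by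
  refine hc.local_bind (P := fun o w => ∃ g, o = some g ∧ (w g).1 = true) fun o => ?_
  rcases o with _ | g
  · simpa using IsLocal.empty
  · simpa using IsLocal.stab g

end Shift

/-! ## Labelled models -/

section Model

variable {G : Type u} {Z : Type v} {d : ℕ}

/-- The configuration seen from the point `q` of a labelled model. -/
def labelConfig (σ : G → Equiv.Perm (Fin d)) (z : Fin d → Z) (q : Fin d) : Config G Z :=
  fun g => (approxStab σ q g, z (σ g q))

/-- The partial map of a labelled model that is described by a code. -/
def modelMap (σ : G → Equiv.Perm (Fin d)) (z : Fin d → Z) (c : Config G Z → Option G)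
    (q : Fin d) : Option (Fin d) :=
  (c (labelConfig σ z q)).map fun g => σ g q

theorem modelMap_domCode_eq_some [Group G] {σ : G → Equiv.Perm (Fin d)} {z : Fin d → Z}
    {c : Config G Z → Option G} {q q' : Fin d} (h : modelMap σ z c q = some q') :
    modelMap σ z (domCode c) q = some (σ 1 q) := by
  obtain ⟨g, hg, -⟩ := Option.map_eq_some_iff.1 h
  simp [modelMap, domCode, hg]

theorem modelMap_eq_some_self [Group G] {σ : G → Equiv.Perm (Fin d)} {z : Fin d → Z}
    {c : Config G Z → Option G} {q : Fin d} :
    modelMap σ z c q = some q ↔ labelConfig σ z q ∈ fixedEvent c := by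
  simp [modelMap, fixedEvent, labelConfig, approxStab]

/-- Codes have finite windows and finitely many values, so only finitely many products of `σ` are
ever used. The set `S` depends on the codes alone and can be fixed before the model is chosen. -/
theorem exists_modelMap_bind [Group G] [MeasurableSpace Z] {c₁ c₂ c₃ : Config G Z → Option G}
    (h₁ : IsCode c₁) (h₂ : IsCode c₂) (h₃ : IsCode c₃) :
    ∃ S : Finset (G × G), ∀ (d : ℕ) (σ : G → Equiv.Perm (Fin d)) (z : Fin d → Z) (q : Fin d),
      (∀ p ∈ S, σ p.1 (σ p.2 q) = σ (p.1 * p.2) q) →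
      labelConfig σ z q ∉ mismatch c₁ c₂ c₃ →
      (modelMap σ z c₁ q).bind (modelMap σ z c₂) = modelMap σ z c₃ q := by
  classical
  obtain ⟨T₂, hT₂⟩ := h₂.exists_window
  obtain ⟨K₁, hK₁⟩ := h₁.exists_values
  obtain ⟨K₂, hK₂⟩ := h₂.exists_values
  obtain ⟨K₃, hK₃⟩ := h₃.exists_values
  -- The first two families identify, on the window of `c₂`, the labels and the stabilizer seen from
  -- `σ g q` with those of the shifted configuration of `q`. The third composes the moves `g` and
  -- `k`, and the last compares `k * g` with the value `k₃` of `c₃`.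
  refine ⟨T₂ ×ˢ K₁ ∪ ((T₂ ×ˢ K₁).image fun p => (p.2, p.2⁻¹ * p.1 * p.2)) ∪ K₂ ×ˢ K₁ ∪
    ((K₂ ×ˢ K₁ ×ˢ K₃).image fun p => (p.1 * p.2.1, (p.1 * p.2.1)⁻¹ * p.2.2)), ?_⟩
  intro d σ z q hq hw
  simp only [Finset.mem_union, Finset.mem_product, Finset.mem_image] at hq
  simp only [mismatch, mem_ofPred_eq, not_not] at hw
  have hshift : ∀ g ∈ K₁, c₂ (labelConfig σ z (σ g q)) = c₂ ((labelConfig σ z q).shift g) := by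
    intro g hg
    refine hT₂ _ _ fun k hk => ?_
    have e1 : σ k (σ g q) = σ (k * g) q := hq (k, g) (by simp [hk, hg])
    have e2 : σ g (σ (g⁻¹ * k * g) q) = σ (k * g) q := by
      have := hq (g, g⁻¹ * k * g) (.inl (.inl (.inr ⟨(k, g), ⟨hk, hg⟩, rfl⟩)))
      simpa [mul_assoc] using this
    refine Prod.ext ?_ ?_
    · simp [labelConfig, Config.shift, approxStab, e1, ← e2]
    · simp [labelConfig, Config.shift, e1]
  rcases e₁ : c₁ (labelConfig σ z q) with _ | g
  · rcases e₃ : c₃ (labelConfig σ z q) with _ | k₃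
    · simp [modelMap, e₁, e₃]
    · simp [e₁, e₃, Config.Agrees] at hw
  have hg := hK₁ _ _ e₁
  have hs := hshift g hg
  rcases e₂ : c₂ ((labelConfig σ z q).shift g) with _ | k
  · rcases e₃ : c₃ (labelConfig σ z q) with _ | k₃
    · simp [modelMap, e₁, e₃, hs, e₂]
    · simp [e₁, e₃, e₂, Config.Agrees] at hw
  have hk := hK₂ _ _ e₂
  rcases e₃ : c₃ (labelConfig σ z q) with _ | k₃
  · simp [e₁, e₃, e₂, Config.Agrees] at hw
  have hk₃ := hK₃ _ _ e₃
  have f1 : σ k (σ g q) = σ (k * g) q := hq (k, g) (by simp [hk, hg])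
  have f2 : σ (k * g) (σ ((k * g)⁻¹ * k₃) q) = σ k₃ q := by
    have := hq (k * g, (k * g)⁻¹ * k₃) (.inr ⟨(k, g, k₃), ⟨hk, hg, hk₃⟩, rfl⟩)
    simpa only [mul_inv_cancel_left] using this
  have f3 : σ ((k * g)⁻¹ * k₃) q = q := by
    simpa [e₁, e₂, e₃, Config.Agrees, labelConfig, approxStab] using hw
  rw [f3] at f2
  simp [modelMap, e₁, e₃, hs, e₂, f1, f2]

end Model

/-! ## The law of a window -/

section Window

variable {G : Type u} {Z : Type v} [MeasurableSpace Z]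

/-- Restricted to the window, `r` factors injectively through the quotient by its kernel, so the
labels read there are i.i.d. over the classes; the filler `z₀` is invisible to `D`. The setoid is a
variable so that two relabellings with equal kernels land on the same quotient type. -/
theorem infinitePi_window_ker (ζ : Measure Z) [IsProbabilityMeasure ζ] {α : Type w} (T : Finset G)
    (r : G → α) (z₀ : Z) {D : Set (G → Z)} (hD : MeasurableSet D)
    (hT : ∀ w w' : G → Z, (∀ f ∈ T, w f = w' f) → w ∈ D → w' ∈ D)
    (s : Setoid T) (hs : s = Setoid.ker fun f : T => r f) [DecidablePred (· ∈ T)] :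
    (Measure.infinitePi fun _ : α => ζ) {z | (fun f => z (r f)) ∈ D} =
      (Measure.infinitePi fun _ : Quotient s => ζ)
        {y | (fun f => if h : f ∈ T then y (Quotient.mk s ⟨f, h⟩) else z₀) ∈ D} := by
  subst hs
  have hm : Measurable fun (y : Quotient (Setoid.ker fun f : T => r f) → Z) (f : G) =>
      if h : f ∈ T then y (Quotient.mk _ ⟨f, h⟩) else z₀ := by
    refine measurable_pi_iff.2 fun f => ?_
    by_cases h : f ∈ T
    · simpa [h] using measurable_pi_apply _
    · simp [h]
  rw [← map_infinitePi_comp ζ _ (Setoid.kerLift_injective fun f : T => r f)]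
  refine Eq.trans ?_ (Measure.map_apply (measurable_relabel _) (hm hD)).symm
  congr 1
  ext z
  constructor
  · exact hT _ _ fun f hf => by simp [hf, Setoid.kerLift_mk]
  · exact hT _ _ fun f hf => by simp [hf, Setoid.kerLift_mk]

/-- The law of a relabelled i.i.d. family on a finite window depends only on the kernel of the
relabelling. -/
theorem infinitePi_window (ζ : Measure Z) [IsProbabilityMeasure ζ] {α : Type*} {β : Type*}
    (T : Finset G) (r : G → α) (r' : G → β)
    (h : ∀ f ∈ T, ∀ f' ∈ T, r f = r f' ↔ r' f = r' f') {D : Set (G → Z)} (hD : MeasurableSet D)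
    (hT : ∀ w w' : G → Z, (∀ f ∈ T, w f = w' f) → w ∈ D → w' ∈ D) :
    (Measure.infinitePi fun _ : α => ζ) {z | (fun f => z (r f)) ∈ D} =
      (Measure.infinitePi fun _ : β => ζ) {z | (fun f => z (r' f)) ∈ D} := by
  classical
  obtain ⟨z₀⟩ : Nonempty Z := nonempty_of_isProbabilityMeasure ζ
  rw [infinitePi_window_ker ζ T r z₀ hD hT _ rfl, infinitePi_window_ker ζ T r' z₀ hD hT
    (Setoid.ker fun f : T => r f)]
  ext f f'
  exact h f f.2 f' f'.2

end Window

section LocalProb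

variable {G : Type u} {Z : Type v} [Group G] [MeasurableSpace Z]

/-- The elements of the window `T` in the coset of `f`, if `b` is the indicator of a subgroup. -/
def cosetWindow (T : Finset G) (b : G → Bool) (f : G) : Set G := {f' | f' ∈ T ∧ b (f⁻¹ * f') = true}

/-- The conditional probability of the event `C` with window `T`, given the stabilizer `b`. -/
def localProb (ζ : Measure Z) (T : Finset G) (C : Set (Config G Z)) (b : G → Bool) : ℝ :=
  (Measure.infinitePi fun _ : Set G => ζ).real {z | (fun f => (b f, z (cosetWindow T b f))) ∈ C}

theorem localProb_mem_Icc (ζ : Measure Z) [IsProbabilityMeasure ζ] (T : Finset G)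
    (C : Set (Config G Z)) (b : G → Bool) : localProb ζ T C b ∈ Icc 0 1 :=
  ⟨measureReal_nonneg, measureReal_le_one⟩

/-- The value depends only on the coordinates of `b` in `T` and `T⁻¹T`, so it is locally constant on
all of `2^G`. Points that are not subgroups have to be included, because approximate stabilizers in
a model need not be subgroups. -/
theorem continuous_localProb (ζ : Measure Z) (T : Finset G) {C : Set (Config G Z)}
    (hT : ∀ w w' : Config G Z, (∀ f ∈ T, w f = w' f) → w ∈ C → w' ∈ C) :
    Continuous (localProb ζ T C) := by
  classical
  refine IsLocallyConstant.continuous ((IsLocallyConstant.iff_exists_open _).2 fun b => ?_)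
  let S : Finset G := T ∪ (T ×ˢ T).image fun p => p.1⁻¹ * p.2
  have hopen : ∀ k, IsOpen {b' : G → Bool | b' k = b k} := fun k =>
    (isOpen_discrete ({b k} : Set Bool)).preimage (continuous_apply (A := fun _ : G => Bool) k)
  refine ⟨⋂ k ∈ S, {b' | b' k = b k}, isOpen_biInter_finset fun k _ => hopen k,
    mem_iInter₂.2 fun k _ => rfl, fun b' hb' => ?_⟩
  have hb : ∀ k ∈ S, b' k = b k := fun k hk => mem_iInter₂.1 hb' k hk
  have h1 : ∀ f ∈ T, b' f = b f := fun f hf => hb f (Finset.mem_union_left _ hf)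
  have h2 : ∀ f ∈ T, cosetWindow T b' f = cosetWindow T b f := by
    intro f hf
    ext f'
    refine and_congr_right fun hf' => ?_
    rw [hb (f⁻¹ * f') (Finset.mem_union_right _
      (Finset.mem_image.2 ⟨(f, f'), Finset.mem_product.2 ⟨hf, hf'⟩, rfl⟩))]
  unfold localProb
  congr 1
  ext z
  constructor
  · exact hT _ _ fun f hf => by simp [h1 f hf, h2 f hf]
  · exact hT _ _ fun f hf => by simp [h1 f hf, h2 f hf]

/-- Any relabelling whose kernel on the window is the coset relation computes `localProb`. -/
theorem infinitePi_eq_localProb (ζ : Measure Z) [IsProbabilityMeasure ζ] {α : Type*}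
    {T : Finset G} {C : Set (Config G Z)} (hC : MeasurableSet C)
    (hT : ∀ w w' : Config G Z, (∀ f ∈ T, w f = w' f) → w ∈ C → w' ∈ C) (b : G → Bool) (r : G → α)
    (hr : ∀ f ∈ T, ∀ f' ∈ T, r f = r f' ↔ b (f⁻¹ * f') = true) :
    (Measure.infinitePi fun _ : α => ζ).real {z | (fun f => (b f, z (r f))) ∈ C} =
      localProb ζ T C b := by
  have hm : Measurable fun (w : G → Z) (f : G) => (b f, w f) :=
    measurable_pi_iff.2 fun f => measurable_const.prodMk (measurable_pi_apply f)
  refine congrArg ENNReal.toReal (infinitePi_window ζ T r (cosetWindow T b) ?_ (hm hC)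
    fun w w' h => hT _ _ fun f hf => by simp [h f hf])
  intro f hf f' hf'
  constructor
  · intro h
    ext k
    refine and_congr_right fun hk => ?_
    rw [← hr f hf k hk, ← hr f' hf' k hk, h]
  · intro h
    have : f' ∈ cosetWindow T b f := by
      rw [h]
      exact ⟨hf', (hr f' hf' f' hf').1 rfl⟩
    exact (hr f hf f' hf').2 this.2

/-- Respecting the products in `hq` turns `σ f q = σ f' q` into `σ (f⁻¹ * f') q = q`, which
`approxStab` records. The equality is exact at such points, so all error comes from the remaining
ones. -/
theorem labelConfig_eq_localProb (ζ : Measure Z) [IsProbabilityMeasure ζ]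
    {T : Finset G} {C : Set (Config G Z)} (hC : MeasurableSet C)
    (hT : ∀ w w' : Config G Z, (∀ f ∈ T, w f = w' f) → w ∈ C → w' ∈ C) {d : ℕ}
    (σ : G → Equiv.Perm (Fin d)) (q : Fin d)
    (hq : ∀ f ∈ T, ∀ f' ∈ T, σ f (σ (f⁻¹ * f') q) = σ f' q) :
    (Measure.infinitePi fun _ : Fin d => ζ).real {z | labelConfig σ z q ∈ C} =
      localProb ζ T C (approxStab σ q) := by
  refine infinitePi_eq_localProb ζ hC hT _ (fun f => σ f q) fun f hf f' hf' => ?_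
  simp only [approxStab, decide_eq_true_eq, ← hq f hf f' hf', EmbeddingLike.apply_eq_iff_eq]
  exact eq_comm

end LocalProb

/-! ### Configurations of points of `Sub_G ⊗ Z` and the probabilities of local events. -/

section Tensor

variable {G : Type u} {Z : Type v} [Group G]

/-- A point of `Sub_G ⊗ Z` as a point of `2^G × Z^G`. -/
def SubTensor.config (x : SubTensor G Z) : Config G Z :=
  fun g => (toCantor x.1 g, x.2 (g : G ⧸ x.1))

theorem SubTensor.config_smul (g : G) (x : SubTensor G Z) :
    (g • x).config = x.config.shift g := by
  funext k
  refine Prod.ext ?_ rfl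
  change toCantor (conjSubgroup g x.1) k = toCantor x.1 (g⁻¹ * k * g)
  simp [toCantor, mem_conjSubgroup]

variable [MeasurableSpace Z]

theorem SubTensor.measurable_config : Measurable (config : SubTensor G Z → Config G Z) := by
  have he : Measurable (embed : SubTensor G Z → _) := comap_measurable _
  exact measurable_pi_iff.2 fun g => ((measurable_pi_apply g).comp
    (measurable_toCantor.comp (measurable_fst.comp he))).prodMk
    ((measurable_pi_apply g).comp (measurable_snd.comp he))

theorem SubTensor.exists_preimage_config {A : Set (SubTensor G Z)} (hA : MeasurableSet A) :
    ∃ B : Set (Config G Z), MeasurableSet B ∧ config ⁻¹' B = A := by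
  have h : @Measurable _ _ (MeasurableSpace.comap config inferInstance) _
      (embed : SubTensor G Z → Subgroup G × (G → Z)) := by
    let _ : MeasurableSpace (SubTensor G Z) := MeasurableSpace.comap config inferInstance
    have hc : Measurable (config : SubTensor G Z → Config G Z) := comap_measurable _
    refine Measurable.prodMk (measurable_comap_iff.2 (measurable_pi_iff.2 fun g => ?_))
      (measurable_pi_iff.2 fun g => ?_)
    · exact measurable_fst.comp ((measurable_pi_apply g).comp hc)
    · exact measurable_snd.comp ((measurable_pi_apply g).comp hc)
  obtain ⟨B, hB, rfl⟩ := hA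
  exact h hB

variable [Countable G]

/-- On the fibre over `K` the relabelling is `f ↦ fK`, whose kernel is the relation recorded by
`toCantor K`. The same function `localProb` thus describes both the Bernoulli shift and the finite
models. -/
theorem tensorMeasure_real_config (η : Measure (Subgroup G)) [IsProbabilityMeasure η]
    (ζ : Measure Z) [IsProbabilityMeasure ζ] {T : Finset G} {C : Set (Config G Z)}
    (hC : MeasurableSet C)
    (hT : ∀ w w' : Config G Z, (∀ f ∈ T, w f = w' f) → w ∈ C → w' ∈ C) :
    (tensorMeasure η ζ).real {x | x.config ∈ C} = ∫ K, localProb ζ T C (toCantor K) ∂η := by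
  have hfib : ∀ K, (fibreMeasure ζ K).real {x | x.config ∈ C} = localProb ζ T C (toCantor K) := by
    intro K
    rw [measureReal_def, fibreMeasure]
    refine (congrArg ENNReal.toReal (Measure.map_apply (measurable_mk K)
      (SubTensor.measurable_config hC))).trans ?_
    refine infinitePi_eq_localProb ζ hC hT (toCantor K) (fun f => (f : G ⧸ K)) fun f _ f' _ => ?_
    simp [toCantor, QuotientGroup.eq]
  simp_rw [← hfib]
  have hA : MeasurableSet {x : SubTensor G Z | x.config ∈ C} := SubTensor.measurable_config hC
  rw [measureReal_def, tensorMeasure_apply η ζ hA]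
  simp_rw [measureReal_def]
  rw [integral_toReal]
  · exact ((Measure.measurable_coe (SubTensor.measurable_config hC)).comp
      (measurable_fibreMeasure ζ)).aemeasurable
  · exact .of_forall fun K => measure_lt_top _ _

end Tensor

/-! ## Sofic models -/

section Sofic

variable {G : Type u} {Z : Type v} [Countable G] [MeasurableSpace Z]

theorem integral_map_uniformLaw {d : ℕ} [NeZero d] (σ : G → Equiv.Perm (Fin d))
    {c : (G → Bool) → ℝ} (hc : Continuous c) :
    ∫ b, c b ∂(ProbabilityMeasure.map (uniformLaw d) (f := approxStab σ)
        (measurable_of_countable _).aemeasurable : Measure (G → Bool)) =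
      (∑ q, c (approxStab σ q)) / d := by
  rw [ProbabilityMeasure.toMeasure_map, integral_map (measurable_of_countable _).aemeasurable
    hc.aestronglyMeasurable, integral_fintype .of_finite, Finset.sum_div]
  refine Finset.sum_congr rfl fun q _ => ?_
  have : (uniformLaw d : Measure (Fin d)).real {q} = (d : ℝ)⁻¹ := by
    simp [uniformLaw, measureReal_def, ProbabilityTheory.uniformOn_univ]
  rw [this, smul_eq_mul, div_eq_inv_mul]

variable [Group G]

/-- In a good enough sofic model with random labels, the local events have almost the right
expected frequencies. -/
theorem exists_sofic_model (ζ : Measure Z) [IsProbabilityMeasure ζ]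
    (η : Measure (Subgroup G)) [IsProbabilityMeasure η] (hsofic : IsSoficIRS η)
    (𝒞 : Finset (Set (Config G Z))) (h𝒞 : ∀ C ∈ 𝒞, IsLocal C) (S : Finset (G × G)) {ε : ℝ}
    (hε : 0 < ε) :
    ∃ (d : ℕ) (_ : NeZero d) (σ : G → Equiv.Perm (Fin d)),
      (∀ C ∈ 𝒞, |(∑ q, (Measure.infinitePi fun _ : Fin d => ζ).real
        {z | labelConfig σ z q ∈ C}) / d - (tensorMeasure η ζ).real {x | x.config ∈ C}| < ε) ∧
      ({q : Fin d | ∃ p ∈ S, σ p.1 (σ p.2 q) ≠ σ (p.1 * p.2) q}.ncard : ℝ) / d < ε := by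
  classical
  have hex : ∀ C : Set (Config G Z), ∃ T : Finset G, C ∈ 𝒞 →
      ∀ w w' : Config G Z, (∀ f ∈ T, w f = w' f) → w ∈ C → w' ∈ C := fun C => by
    by_cases h : C ∈ 𝒞
    · exact (h𝒞 C h).exists_window.imp fun _ h _ => h
    · exact ⟨∅, fun h' => (h h').elim⟩
  choose T hT using hex
  -- The added pairs are the products required by `labelConfig_eq_localProb` on each window.
  let S' : Finset (G × G) := S ∪ 𝒞.biUnion fun C => (T C ×ˢ T C).image fun p => (p.1, p.1⁻¹ * p.2)
  let K : Finset G := S'.image Prod.fst ∪ S'.image Prod.snd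
  -- A union bound over `S'` then leaves fewer than `ε / 2 * d` bad points; the other half of `ε`
  -- goes to the weak approximation.
  let δ : ℝ := ε / (2 * (S'.card + 1))
  have hδ : 0 < δ := by positivity
  let e : ProbabilityMeasure (G → Bool) :=
    ProbabilityMeasure.map (⟨η, inferInstance⟩ : ProbabilityMeasure (Subgroup G))
      (f := toCantor) measurable_toCantor.aemeasurable
  let Ω : Set (ProbabilityMeasure (G → Bool)) := ⋂ C ∈ 𝒞,
    {ν | |∫ b, localProb ζ (T C) C b ∂(ν : Measure (G → Bool)) -
      ∫ b, localProb ζ (T C) C b ∂(e : Measure (G → Bool))| < ε / 2}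
  have hΩ : IsOpen Ω := by
    refine isOpen_biInter_finset fun C hC => ?_
    have hc : Continuous fun ν : ProbabilityMeasure (G → Bool) =>
        ∫ b, localProb ζ (T C) C b ∂(ν : Measure (G → Bool)) :=
      ProbabilityMeasure.continuous_integral_boundedContinuousFunction
        (f := .mkOfCompact ⟨_, continuous_localProb ζ (T C) (hT C hC)⟩)
    exact isOpen_lt (hc.sub continuous_const).abs continuous_const
  obtain ⟨d, hd, σ, hmul, hlaw⟩ := hsofic δ hδ K Ω hΩ (by simp [Ω, e, hε])
  have hd0 : (0 : ℝ) < d := by exact_mod_cast Nat.pos_of_ne_zero hd.ne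
  let bad : Finset (Fin d) := {q | ∃ p ∈ S', σ p.1 (σ p.2 q) ≠ σ (p.1 * p.2) q}
  have hbad : (bad.card : ℝ) / d < ε / 2 := by
    have h1 : ∀ p ∈ S', (({q | σ p.1 (σ p.2 q) ≠ σ (p.1 * p.2) q} : Finset (Fin d)).card : ℝ) ≤
        δ * d := by
      intro p hp
      have := hmul p.1 (Finset.mem_union_left _ (Finset.mem_image_of_mem _ hp)) p.2
        (Finset.mem_union_right _ (Finset.mem_image_of_mem _ hp))
      rw [le_div_iff₀ hd0] at this
      have h2 := Finset.card_filter_add_card_filter_not (s := (Finset.univ : Finset (Fin d)))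
        (fun q => σ p.1 (σ p.2 q) = σ (p.1 * p.2) q)
      have h3 : {q : Fin d | σ p.1 (σ p.2 q) = σ (p.1 * p.2) q}.ncard =
          ({q | σ p.1 (σ p.2 q) = σ (p.1 * p.2) q} : Finset (Fin d)).card := by
        rw [← Set.ncard_coe_finset]; simp
      rw [h3] at this
      rw [Finset.card_univ, Fintype.card_fin] at h2
      have h4 : ((Finset.card {q | σ p.1 (σ p.2 q) = σ (p.1 * p.2) q} : ℝ) +
        (Finset.card {q | ¬ σ p.1 (σ p.2 q) = σ (p.1 * p.2) q} : ℝ)) = d := by exact_mod_cast h2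
      change ((Finset.card {q | ¬ σ p.1 (σ p.2 q) = σ (p.1 * p.2) q} : ℝ)) ≤ _
      linarith
    have h2 : bad ⊆ S'.biUnion fun p => {q | σ p.1 (σ p.2 q) ≠ σ (p.1 * p.2) q} := by
      intro q hq
      simpa [bad] using hq
    have h3 : (bad.card : ℝ) ≤ S'.card * (δ * d) := by
      calc (bad.card : ℝ) ≤ ∑ p ∈ S', (({q | σ p.1 (σ p.2 q) ≠ σ (p.1 * p.2) q} :
            Finset (Fin d)).card : ℝ) := by
            exact_mod_cast (Finset.card_le_card h2).trans Finset.card_biUnion_le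
        _ ≤ ∑ p ∈ S', δ * d := Finset.sum_le_sum h1
        _ = _ := by simp
    rw [div_lt_iff₀ hd0]
    refine h3.trans_lt ?_
    have : (S'.card : ℝ) * δ < ε / 2 := by
      simp only [δ]
      rw [← mul_div_assoc, div_lt_div_iff₀ (by positivity) (by positivity)]
      nlinarith
    nlinarith
  have hS'bad : ∀ q ∉ bad, ∀ p ∈ S', σ p.1 (σ p.2 q) = σ (p.1 * p.2) q := by
    intro q hq p hp
    by_contra h
    exact hq (by simpa [bad] using ⟨p.1, p.2, hp, h⟩)
  refine ⟨d, hd, σ, fun C hC => ?_, ?_⟩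
  · have hcont := continuous_localProb ζ (T C) (hT C hC)
    have h1 := mem_iInter₂.1 hlaw C hC
    simp only [mem_ofPred_eq] at h1
    rw [integral_map_uniformLaw σ hcont] at h1
    have h2 : ∫ b, localProb ζ (T C) C b ∂(e : Measure (G → Bool)) =
        (tensorMeasure η ζ).real {x | x.config ∈ C} := by
      rw [tensorMeasure_real_config η ζ (h𝒞 C hC).measurableSet (hT C hC)]
      exact integral_map measurable_toCantor.aemeasurable hcont.aestronglyMeasurable
    rw [h2] at h1
    -- Good points contribute no error, and a bad point contributes at most 1 since both terms are
    -- probabilities.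
    have h3 : |(∑ q, (Measure.infinitePi fun _ : Fin d => ζ).real
        {z | labelConfig σ z q ∈ C}) - ∑ q, localProb ζ (T C) C (approxStab σ q)| ≤ bad.card := by
      rw [← Finset.sum_sub_distrib]
      refine (Finset.abs_sum_le_sum_abs _ _).trans ?_
      calc _ ≤ ∑ q, if q ∈ bad then (1 : ℝ) else 0 := by
            refine Finset.sum_le_sum fun q _ => ?_
            split_ifs with hq
            · have ha := localProb_mem_Icc ζ (T C) C (approxStab σ q)
              have hb1 : (Measure.infinitePi fun _ : Fin d => ζ).real
                {z | labelConfig σ z q ∈ C} ≤ 1 := measureReal_le_one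
              have hb0 : 0 ≤ (Measure.infinitePi fun _ : Fin d => ζ).real
                {z | labelConfig σ z q ∈ C} := measureReal_nonneg
              exact abs_le.2 ⟨by linarith [ha.2], by linarith [ha.1]⟩
            · rw [labelConfig_eq_localProb ζ (h𝒞 C hC).measurableSet (hT C hC) σ q, sub_self,
                abs_zero]
              intro f hf f' hf'
              have := hS'bad q hq (f, f⁻¹ * f') (Finset.mem_union_right _ (Finset.mem_biUnion.2
                ⟨C, hC, Finset.mem_image.2 ⟨(f, f'), Finset.mem_product.2 ⟨hf, hf'⟩, rfl⟩⟩))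
              simpa using this
        _ = _ := by simp
    have h4 : |(∑ q, (Measure.infinitePi fun _ : Fin d => ζ).real
        {z | labelConfig σ z q ∈ C}) / d - (∑ q, localProb ζ (T C) C (approxStab σ q)) / d| <
        ε / 2 := by
      rw [← sub_div, abs_div, abs_of_pos hd0]
      exact (div_le_div_of_nonneg_right h3 hd0.le).trans_lt hbad
    calc _ ≤ _ := abs_sub_le _ _ _
      _ < ε / 2 + ε / 2 := add_lt_add h4 h1
      _ = ε := by ring
  · refine lt_of_le_of_lt (div_le_div_of_nonneg_right ?_ hd0.le) (hbad.trans (by linarith))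
    rw [← Set.ncard_coe_finset]
    refine Nat.cast_le.2 (Set.ncard_le_ncard ?_ (Set.toFinite _))
    rintro q ⟨p, hp, h⟩
    simpa [bad] using ⟨p.1, p.2, Finset.mem_union_left _ hp, h⟩

end Sofic

/-! ## Deterministic labels -/

/-- Finitely many expectations are approximated simultaneously by the averages over one finite
sample. -/
theorem exists_sample {Ω : Type*} [MeasurableSpace Ω] (P : Measure Ω) [IsProbabilityMeasure P]
    {ι : Type*} (s : Finset ι) (h : ι → Ω → ℝ) (hm : ∀ i ∈ s, Measurable (h i))
    (hi : ∀ i ∈ s, Integrable (h i) P) {ε : ℝ} (hε : 0 < ε) (N₀ : ℕ) :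
    ∃ N, N₀ ≤ N ∧ 0 < N ∧ ∃ ω : ℕ → Ω,
      ∀ i ∈ s, |(∑ k ∈ Finset.range N, h i (ω k)) / N - ∫ x, h i x ∂P| < ε := by
  have hmp : ∀ k, MeasurePreserving (fun ω : ℕ → Ω => ω k) (Measure.infinitePi fun _ => P) P :=
    fun k => ⟨measurable_pi_apply k, Measure.infinitePi_map_eval _ k⟩
  have key : ∀ i ∈ s, ∀ᵐ ω ∂(Measure.infinitePi fun _ : ℕ => P),
      Tendsto (fun n : ℕ => (∑ k ∈ Finset.range n, h i (ω k)) / n) atTop (𝓝 (∫ x, h i x ∂P)) := by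
    intro i his
    have := ProbabilityTheory.strong_law_ae_real (μ := Measure.infinitePi fun _ : ℕ => P)
      (fun k ω => h i (ω k)) ((hmp 0).integrable_comp_of_integrable (hi i his))
      (fun k l hkl => (ProbabilityTheory.iIndepFun_infinitePi (X := fun _ : ℕ => h i)
        fun _ => hm i his).indepFun hkl)
      (fun k => ⟨((hm i his).comp (measurable_pi_apply k)).aemeasurable,
        ((hm i his).comp (measurable_pi_apply 0)).aemeasurable, by
          change Measure.map (h i ∘ fun ω : ℕ → Ω => ω k) _ =
            Measure.map (h i ∘ fun ω : ℕ → Ω => ω 0) _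
          rw [← Measure.map_map (hm i his) (measurable_pi_apply k),
            ← Measure.map_map (hm i his) (measurable_pi_apply 0), (hmp k).map_eq, (hmp 0).map_eq]⟩)
    have e : ∫ ω, h i (ω 0) ∂(Measure.infinitePi fun _ : ℕ => P) = ∫ x, h i x ∂P := by
      have := integral_map (μ := Measure.infinitePi fun _ : ℕ => P)
        (hmp 0).measurable.aemeasurable (hm i his).aestronglyMeasurable
      rw [(hmp 0).map_eq] at this
      exact this.symm
    rwa [e] at this
  obtain ⟨ω, hω⟩ := ((eventually_all_finset s).2 key).exists
  have h2 : ∀ᶠ n : ℕ in atTop, ∀ i ∈ s,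
      |(∑ k ∈ Finset.range n, h i (ω k)) / n - ∫ x, h i x ∂P| < ε :=
    (eventually_all_finset s).2 fun i his => by
      simpa [Real.dist_eq] using (hω i his).eventually (Metric.ball_mem_nhds _ hε)
  obtain ⟨N, hN, hN₀⟩ := (h2.and (eventually_ge_atTop (N₀ + 1))).exists
  exact ⟨N, by omega, by omega, ω, hN⟩

theorem ncard_finProd {N d : ℕ} (P : Fin (N * d) → Prop) :
    ({p | P p}.ncard : ℝ) =
      ∑ k : Fin N, ({q : Fin d | P (finProdFinEquiv (k, q))}.ncard : ℝ) := by
  classical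
  have h : ∀ (n : ℕ) (Q : Fin n → Prop), ({q | Q q}.ncard : ℝ) = ∑ q, if Q q then 1 else 0 := by
    intro n Q
    rw [Finset.sum_boole, ← Set.ncard_coe_finset]
    simp
  simp_rw [h]
  rw [← finProdFinEquiv.sum_comp, Fintype.sum_prod_type]

/-- Disjoint copies of a permutation. -/
def copies (N : ℕ) {d : ℕ} (π : Equiv.Perm (Fin d)) : Equiv.Perm (Fin (N * d)) :=
  finProdFinEquiv.permCongr (Equiv.prodCongrRight fun _ => π)

theorem copies_apply (N : ℕ) {d : ℕ} (π : Equiv.Perm (Fin d)) (k : Fin N) (q : Fin d) :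
    copies N π (finProdFinEquiv (k, q)) = finProdFinEquiv (k, π q) := by
  simp [copies, Equiv.permCongr_apply]

section Labelled

variable {G : Type u} {Z : Type v}

theorem labelConfig_copies {N d : ℕ} (σ : G → Equiv.Perm (Fin d)) (ω : Fin N → Fin d → Z)
    (k : Fin N) (q : Fin d) :
    labelConfig (fun g => copies N (σ g)) (fun p => ω (finProdFinEquiv.symm p).1
      (finProdFinEquiv.symm p).2) (finProdFinEquiv (k, q)) = labelConfig σ (ω k) q := by
  funext g
  simp [labelConfig, approxStab, copies_apply]

variable [MeasurableSpace Z]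

theorem measurable_labelConfig {d : ℕ} (σ : G → Equiv.Perm (Fin d)) (q : Fin d) :
    Measurable fun z : Fin d → Z => labelConfig σ z q :=
  measurable_pi_iff.2 fun g => measurable_const.prodMk (measurable_pi_apply (σ g q))

variable [Group G] [Countable G]

/-- There are labelled models in which finitely many given local events have almost the right
frequency, and in which almost all points respect finitely many given products. -/
theorem exists_labelled_model (ζ : Measure Z) [IsProbabilityMeasure ζ]
    (η : Measure (Subgroup G)) [IsProbabilityMeasure η] (hsofic : IsSoficIRS η)
    (𝒞 : Finset (Set (Config G Z))) (h𝒞 : ∀ C ∈ 𝒞, IsLocal C) (S : Finset (G × G)) {ε : ℝ}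
    (hε : 0 < ε) (D₀ : ℕ) :
    ∃ d, D₀ ≤ d ∧ 0 < d ∧ ∃ (σ : G → Equiv.Perm (Fin d)) (z : Fin d → Z),
      (∀ C ∈ 𝒞, |({q | labelConfig σ z q ∈ C}.ncard : ℝ) / d -
        (tensorMeasure η ζ).real {x | x.config ∈ C}| < ε) ∧
      ({q : Fin d | ∃ p ∈ S, σ p.1 (σ p.2 q) ≠ σ (p.1 * p.2) q}.ncard : ℝ) / d < ε := by
  classical
  obtain ⟨d, hd, σ, hC, hbad⟩ := exists_sofic_model ζ η hsofic 𝒞 h𝒞 S (half_pos hε)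
  have hd' : 0 < d := Nat.pos_of_ne_zero hd.ne
  have hd0 : (0 : ℝ) < d := by exact_mod_cast hd'
  have hE : ∀ C ∈ 𝒞, ∀ q, MeasurableSet {z : Fin d → Z | labelConfig σ z q ∈ C} :=
    fun C hC q => measurable_labelConfig σ q (h𝒞 C hC).measurableSet
  let h : Set (Config G Z) → (Fin d → Z) → ℝ := fun C z =>
    (∑ q, {z : Fin d → Z | labelConfig σ z q ∈ C}.indicator 1 z) / d
  have hcount : ∀ C z, h C z = ({q | labelConfig σ z q ∈ C}.ncard : ℝ) / d := by
    intro C z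
    simp only [h, indicator_apply, mem_ofPred_eq, Pi.one_apply]
    rw [Finset.sum_boole, ← Set.ncard_coe_finset]
    simp
  have hint1 : ∀ C ∈ 𝒞, ∀ q, Integrable ({z : Fin d → Z | labelConfig σ z q ∈ C}.indicator
      (1 : (Fin d → Z) → ℝ)) (Measure.infinitePi fun _ => ζ) := fun C hC q =>
    (integrable_const (1 : ℝ)).indicator (hE C hC q)
  -- The average of `h C` over `N` labellings of `d` points is the frequency of `C` in one model of
  -- `N` disjoint copies. The bound `D₀ ≤ N` also makes that model large.
  obtain ⟨N, hN₀, hN, ω, hω⟩ := exists_sample (Measure.infinitePi fun _ : Fin d => ζ) 𝒞 h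
    (fun C hC => (Finset.measurable_sum _ fun q _ =>
      measurable_one.indicator (hE C hC q)).div_const _)
    (fun C hC => (integrable_finsetSum _ fun q _ => hint1 C hC q).div_const _) (half_pos hε) D₀
  have hN0 : (0 : ℝ) < N := by exact_mod_cast hN
  refine ⟨N * d, hN₀.trans (Nat.le_mul_of_pos_right N hd'), Nat.mul_pos hN hd',
    fun g => copies N (σ g), fun p => ω (finProdFinEquiv.symm p).1 (finProdFinEquiv.symm p).2,
    fun C hC' => ?_, ?_⟩
  · have h1 := hω C hC'
    have h2 := hC C hC'
    have e : ∫ z, h C z ∂(Measure.infinitePi fun _ : Fin d => ζ) =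
        (∑ q, (Measure.infinitePi fun _ : Fin d => ζ).real {z | labelConfig σ z q ∈ C}) / d := by
      simp only [h]
      rw [integral_div, integral_finsetSum _ fun q _ => hint1 C hC' q]
      congr 1
      exact Finset.sum_congr rfl fun q _ => integral_indicator_one (hE C hC' q)
    rw [e] at h1
    have e2 : ({p | labelConfig (fun g => copies N (σ g)) (fun p => ω (finProdFinEquiv.symm p).1
        (finProdFinEquiv.symm p).2) p ∈ C}.ncard : ℝ) / (N * d : ℕ) =
        (∑ k ∈ Finset.range N, h C (ω k)) / N := by
      rw [ncard_finProd]
      simp_rw [labelConfig_copies σ (fun k : Fin N => ω k), hcount]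
      rw [Finset.sum_range, ← Finset.sum_div, div_div, Nat.cast_mul, mul_comm (d : ℝ)]
    rw [e2]
    calc _ ≤ _ := abs_sub_le _ _ _
      _ < ε / 2 + ε / 2 := add_lt_add h1 h2
      _ = ε := by ring
  · rw [ncard_finProd]
    simp_rw [copies_apply, ne_eq, EmbeddingLike.apply_eq_iff_eq, Prod.mk.injEq, true_and]
    rw [Finset.sum_const, Finset.card_univ, Fintype.card_fin, nsmul_eq_mul, Nat.cast_mul,
      mul_div_mul_left _ _ hN0.ne']
    exact hbad.trans (by linarith)

end Labelled

/-! ## Partial automorphisms of a principal groupoid as partial maps -/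

namespace PMPGroupoid

variable {Ob : Type u} {H : Type v} [MeasurableSpace Ob] [StandardBorelSpace Ob]
  [MeasurableSpace H] [StandardBorelSpace H] {𝓗 : PMPGroupoid Ob H}

theorem IsPartialAut.injOn_src {s : Set H} (hs : 𝓗.IsPartialAut s) : InjOn 𝓗.src s :=
  injOn_iff_injective.2 hs.src.injective

theorem IsPartialAut.injOn_rng {s : Set H} (hs : 𝓗.IsPartialAut s) : InjOn 𝓗.rng s :=
  injOn_iff_injective.2 hs.rng.injective

theorem isPartialAut_of_injOn {s : Set H} (hs : MeasurableSet s) (h1 : InjOn 𝓗.src s)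
    (h2 : InjOn 𝓗.rng s) : 𝓗.IsPartialAut s := by
  have : StandardBorelSpace s := hs.standardBorel
  exact ⟨hs, (𝓗.measurable_src.comp measurable_subtype_coe).measurableEmbedding
    (injOn_iff_injective.1 h1), (𝓗.measurable_rng.comp measurable_subtype_coe).measurableEmbedding
    (injOn_iff_injective.1 h2)⟩

/-- Invariance `pmp` lets `mass` be counted along range fibres, and each point of the image has a
nonempty one. With the source-side bound `mass_le`, this shows that partial automorphisms do not
increase measure. -/
theorem IsPartialAut.measure_rng_image_le {s E : Set H} (hs : 𝓗.IsPartialAut s) (hE : E ⊆ s)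
    (hm : MeasurableSet E) : 𝓗.ν (𝓗.rng '' E) ≤ 𝓗.mass E := by
  have hmi : MeasurableSet (𝓗.rng '' E) :=
    hm.image_of_measurable_injOn 𝓗.measurable_rng (hs.injOn_rng.mono hE)
  rw [mass, 𝓗.pmp E hm, ← lintegral_indicator_one hmi]
  refine lintegral_mono fun x => ?_
  by_cases hx : x ∈ 𝓗.rng '' E
  · obtain ⟨p, hp, rfl⟩ := hx
    rw [indicator_of_mem (mem_image_of_mem _ hp), Pi.one_apply]
    have : (1 : ℕ∞) ≤ (𝓗.rng ⁻¹' {𝓗.rng p} ∩ E).encard :=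
      one_le_encard_iff_nonempty.2 ⟨p, rfl, hp⟩
    simpa using ENat.toENNReal_le.2 this
  · rw [indicator_of_notMem hx]
    exact zero_le

theorem IsPartialAut.mass_le {s E : Set H} (hs : 𝓗.IsPartialAut s) (hE : E ⊆ s) {B : Set Ob}
    (hB : MeasurableSet B) (hEB : MapsTo 𝓗.src E B) : 𝓗.mass E ≤ 𝓗.ν B := by
  rw [mass, ← lintegral_indicator_one hB]
  refine lintegral_mono fun x => ?_
  by_cases hx : x ∈ B
  · rw [indicator_of_mem hx, Pi.one_apply]
    have : (𝓗.src ⁻¹' {x} ∩ E).encard ≤ 1 := encard_le_one_iff.2 fun p q hp hq =>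
      hs.injOn_src (hE hp.2) (hE hq.2) (hp.1.trans hq.1.symm)
    simpa using ENat.toENNReal_le.2 this
  · have : 𝓗.src ⁻¹' {x} ∩ E = ∅ := by
      ext p
      simp only [mem_inter_iff, mem_preimage, mem_singleton_iff, mem_empty_iff_false, iff_false]
      rintro ⟨rfl, hp⟩
      exact hx (hEB hp)
    simp [this]

end PMPGroupoid

section PartialMap

variable {G : Type u} {X : Type v} [Group G] [MulAction G X]

open Classical in
/-- The partial map `x ↦ y` for `(x, y) ∈ s`. -/
def partialMap (s : Set (OrbitRelation G X)) (x : X) : Option X :=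
  if h : ∃ p ∈ s, p.1.1 = x then some h.choose.1.2 else none

variable [Countable G] [MeasurableSpace X] [StandardBorelSpace X] [MeasurableConstSMul G X]
  {μ : Measure X} [IsProbabilityMeasure μ] {hμ : ∀ g : G, MeasurePreserving (g • · : X → X) μ μ}

section
variable {s t : Set (OrbitRelation G X)} (hs : (principalGroupoid G X μ hμ).IsPartialAut s)
include hs

theorem partialMap_eq_some {x y : X} :
    partialMap s x = some y ↔ ∃ p ∈ s, p.1.1 = x ∧ p.1.2 = y := by
  constructor
  · intro h
    unfold partialMap at h
    split_ifs at h with hx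
    exact ⟨hx.choose, hx.choose_spec.1, hx.choose_spec.2, Option.some.inj h⟩
  · rintro ⟨p, hp, rfl, rfl⟩
    have hx : ∃ q ∈ s, q.1.1 = p.1.1 := ⟨p, hp, rfl⟩
    unfold partialMap
    rw [dif_pos hx]
    have : hx.choose = p := hs.injOn_rng hx.choose_spec.1 hp hx.choose_spec.2
    rw [this]

/-- Arrows are followed from range to source, so in `(x, y)(y, z) = (x, z)` the left factor acts
first, and `bind` keeps the order of the factors. -/
theorem partialMap_setMul (ht : (principalGroupoid G X μ hμ).IsPartialAut t) (x : X) :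
    partialMap ((principalGroupoid G X μ hμ).setMul s t) x =
      (partialMap s x).bind (partialMap t) := by
  refine Option.ext fun z => ?_
  rw [partialMap_eq_some (hs.setMul _ ht), Option.bind_eq_some_iff]
  simp only [partialMap_eq_some hs, partialMap_eq_some ht]
  constructor
  · rintro ⟨_, ⟨a, ha, b, hb, hab, rfl⟩, rfl, rfl⟩
    exact ⟨a.1.2, ⟨a, ha, rfl, rfl⟩, b, hb, hab.symm, rfl⟩
  · rintro ⟨y, ⟨a, ha, rfl, rfl⟩, b, hb, hab, rfl⟩
    exact ⟨_, ⟨a, ha, b, hb, hab.symm, rfl⟩, rfl, rfl⟩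

theorem isPartialAut_inv : (principalGroupoid G X μ hμ).IsPartialAut
    ((principalGroupoid G X μ hμ).inv ⁻¹' s) := by
  have hinj : Function.Injective (principalGroupoid G X μ hμ).inv := fun p q h =>
    Subtype.ext (Prod.ext (congrArg (fun r => r.1.2) h) (congrArg (fun r => r.1.1) h))
  refine PMPGroupoid.isPartialAut_of_injOn
    ((principalGroupoid G X μ hμ).measurable_inv hs.measurableSet) ?_ ?_
  · exact fun p hp q hq h => hinj (hs.injOn_rng hp hq h)
  · exact fun p hp q hq h => hinj (hs.injOn_src hp hq h)

theorem partialMap_inv {x y : X} (h : partialMap s x = some y) :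
    partialMap ((principalGroupoid G X μ hμ).inv ⁻¹' s) y = some x := by
  obtain ⟨p, hp, rfl, rfl⟩ := (partialMap_eq_some hs).1 h
  exact (partialMap_eq_some (isPartialAut_inv hs)).2
    ⟨(principalGroupoid G X μ hμ).inv p, hp, rfl, rfl⟩

/-- Partial automorphisms preserve the measure. -/
theorem measure_partialMap_le (B : Set X) : μ {x | ∃ y ∈ B, partialMap s x = some y} ≤ μ B := by
  let 𝓗 := principalGroupoid G X μ hμ
  -- The set `B` will be the exceptional set of a code, for which no measurability is established,
  -- so a measurable hull is used.
  let B' := toMeasurable μ B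
  have hB' : MeasurableSet B' := measurableSet_toMeasurable μ B
  let E : Set (OrbitRelation G X) := s ∩ 𝓗.src ⁻¹' B'
  have h1 := hs.measure_rng_image_le (E := E) inter_subset_left
    (hs.measurableSet.inter (𝓗.measurable_src hB'))
  have h2 := hs.mass_le (E := E) inter_subset_left hB' fun p hp => hp.2
  refine (measure_mono ?_).trans ((h1.trans h2).trans (measure_toMeasurable B).le)
  rintro x ⟨y, hy, h⟩
  obtain ⟨p, hp, rfl, rfl⟩ := (partialMap_eq_some hs).1 h
  exact ⟨p, ⟨hp, subset_toMeasurable μ B hy⟩, rfl⟩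

/-- A point where the two maps differ is the range of an arrow in `s \ t` or in `t \ s`, and the
ranges of these sets are null. -/
theorem partialMap_ae_eq (ht : (principalGroupoid G X μ hμ).IsPartialAut t)
    (h : (principalGroupoid G X μ hμ).mass (symmDiff s t) = 0) :
    ∀ᵐ x ∂μ, partialMap s x = partialMap t x := by
  let 𝓗 := principalGroupoid G X μ hμ
  have hz : ∀ {s t : Set (OrbitRelation G X)}, 𝓗.IsPartialAut s → 𝓗.IsPartialAut t →
      𝓗.mass (symmDiff s t) = 0 → μ (𝓗.rng '' (s \ t)) = 0 := by
    intro s t hs ht h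
    refine le_antisymm ((hs.measure_rng_image_le sdiff_subset
      (hs.measurableSet.diff ht.measurableSet)).trans ?_) zero_le
    rw [← h]
    refine lintegral_mono fun x => ?_
    exact ENat.toENNReal_le.2 (encard_le_encard (inter_subset_inter_right _ subset_union_left))
  have h1 := hz hs ht h
  have h2 := hz ht hs (by rwa [symmDiff_comm])
  refine measure_mono_null (fun x hx => ?_) (measure_union_null h1 h2)
  by_contra hx'
  simp only [mem_union, not_or] at hx'
  refine hx (Option.ext fun y => ?_)
  rw [partialMap_eq_some hs, partialMap_eq_some ht]
  constructor
  · rintro ⟨p, hp, rfl, rfl⟩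
    by_contra hcon
    exact hx'.1 ⟨p, ⟨hp, fun hp' => hcon ⟨p, hp', rfl, rfl⟩⟩, rfl⟩
  · rintro ⟨p, hp, rfl, rfl⟩
    by_contra hcon
    exact hx'.2 ⟨p, ⟨hp, fun hp' => hcon ⟨p, hp', rfl, rfl⟩⟩, rfl⟩

theorem measurableSet_partialMap_eq_smul (g : G) :
    MeasurableSet {x | partialMap s x = some (g • x)} := by
  let e : X → OrbitRelation G X := fun x => ⟨(x, g • x), g, rfl⟩
  have he : Measurable e := (measurable_id.prodMk (measurable_const_smul g)).subtype_mk
  convert he hs.measurableSet using 1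
  ext x
  rw [mem_ofPred_eq, partialMap_eq_some hs]
  constructor
  · rintro ⟨p, hp, h1, h2⟩
    have : e x = p := Subtype.ext (Prod.ext h1.symm h2.symm)
    rwa [mem_preimage, this]
  · intro h
    exact ⟨e x, h, rfl, rfl⟩

theorem exists_partialMap_eq_smul {x y : X} (h : partialMap s x = some y) : ∃ g : G, g • x = y := by
  obtain ⟨p, hp, rfl, rfl⟩ := (partialMap_eq_some hs).1 h
  exact p.2

end

theorem trace_eq (s : (principalGroupoid G X μ hμ).PartialAut) :
    (principalGroupoid G X μ hμ).trace s = μ.real {x | partialMap s.1 x = some x} := by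
  change μ.real _ = _
  congr 1
  ext x
  rw [mem_ofPred_eq, partialMap_eq_some s.2]
  constructor
  · intro h
    exact ⟨_, h, rfl, rfl⟩
  · rintro ⟨p, hp, h1, h2⟩
    have : (principalGroupoid G X μ hμ).unit x = p := Subtype.ext (Prod.ext h1.symm h2.symm)
    rwa [mem_preimage, this]

end PartialMap

/-! ## Codes on non-free Bernoulli shifts -/

section CodeMap

variable {G : Type u} {Z : Type v} [Group G]

/-- The partial map of `Sub_G ⊗ Z` that is described by a code. -/
def codeMap (c : Config G Z → Option G) (x : SubTensor G Z) : Option (SubTensor G Z) :=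
  (c x.config).map (· • x)

theorem codeMap_domCode (c : Config G Z → Option G) (x : SubTensor G Z) :
    codeMap (domCode c) x = (codeMap c x).map fun _ => x := by
  rcases h : c x.config with _ | g <;> simp [codeMap, domCode, h]

/-- An element of `L` normalizes `L` and satisfies `fgL = fL`. This direction holds at every point;
the converse holds only almost everywhere and needs non-atomicity. -/
theorem SubTensor.smul_eq_of_mem {x : SubTensor G Z} {g : G} (hg : g ∈ x.1) : g • x = x := by
  apply embed_injective
  rw [embed_smul]
  refine Prod.ext ?_ ?_
  · ext k
    rw [mem_conjSubgroup]
    change g⁻¹ * k * g ∈ x.1 ↔ k ∈ x.1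
    rw [x.1.mul_mem_cancel_right hg, x.1.mul_mem_cancel_left (x.1.inv_mem hg)]
  · funext f
    change x.2 ((f * g : G) : G ⧸ x.1) = x.2 (f : G ⧸ x.1)
    exact congrArg x.2 (QuotientGroup.eq.2 (by simpa using hg))

theorem SubTensor.config_fst (x : SubTensor G Z) (g : G) : (x.config g).1 = true ↔ g ∈ x.1 := by
  simp [config, toCantor]

/-- A mismatch compares group elements modulo the recorded subgroup, whereas `h` compares points of
the orbit. By `hx` the recorded subgroup contains the stabilizer, so equal points come from equal
cosets. -/
theorem config_notMem_mismatch {c₁ c₂ c₃ : Config G Z → Option G} {x : SubTensor G Z}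
    (hx : ∀ g : G, g • x = x → g ∈ x.1)
    (h : (codeMap c₁ x).bind (codeMap c₂) = codeMap c₃ x) : x.config ∉ mismatch c₁ c₂ c₃ := by
  rw [mismatch, mem_ofPred_eq, not_not]
  rcases e₁ : c₁ x.config with _ | g
  · rcases e₃ : c₃ x.config with _ | k₃
    · simp [Config.Agrees]
    · simp [codeMap, e₁, e₃] at h
  rcases e₂ : c₂ (x.config.shift g) with _ | k <;> rcases e₃ : c₃ x.config with _ | k₃
  · simp [Config.Agrees, e₂]
  · simp [codeMap, e₁, e₃, SubTensor.config_smul, e₂] at h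
  · simp [codeMap, e₁, e₃, SubTensor.config_smul, e₂] at h
  · simp only [codeMap, e₁, e₃, SubTensor.config_smul, e₂, Option.map_some, Option.bind_some,
      Option.some.injEq] at h
    simp only [Option.bind_some, e₂, Option.map_some, Config.Agrees]
    rw [SubTensor.config_fst]
    apply hx
    rw [mul_smul, ← h, inv_smul_eq_iff, mul_smul]

theorem codeMap_eq_some_self {c : Config G Z → Option G} {x : SubTensor G Z}
    (hx : ∀ g : G, g • x = x → g ∈ x.1) : codeMap c x = some x ↔ x.config ∈ fixedEvent c := by
  rw [codeMap, Option.map_eq_some_iff, fixedEvent, mem_ofPred_eq]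
  refine exists_congr fun g => and_congr_right fun _ => ?_
  rw [SubTensor.config_fst]
  exact ⟨hx g, SubTensor.smul_eq_of_mem⟩

end CodeMap

/-! ### Stabilizers of almost every point. -/

section Stabilizers

variable {G : Type u} {Z : Type v} [Group G] [Countable G] [MeasurableSpace Z]
  [StandardBorelSpace Z]

/-- Two coordinates have joint law `ζ × ζ`, and the slices of the diagonal are single points, which
are null. -/
theorem infinitePi_eval_eq_null (ζ : Measure Z) [IsProbabilityMeasure ζ] [NullSingletonClass ζ]
    {ι : Type*} {i j : ι} (hij : i ≠ j) :
    (Measure.infinitePi fun _ : ι => ζ) {ω | ω i = ω j} = 0 := by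
  have hd : MeasurableSet {p : Z × Z | p.1 = p.2} :=
    measurableSet_eq_fun measurable_fst measurable_snd
  have hm : Measurable fun ω : ι → Z => (ω i, ω j) :=
    (measurable_pi_apply i).prodMk (measurable_pi_apply j)
  have h := Measure.infinitePi_map_eval_prod (P := fun _ : ι => ζ) hij
  calc (Measure.infinitePi fun _ : ι => ζ) {ω | ω i = ω j}
      = (Measure.infinitePi fun _ : ι => ζ).map (fun ω => (ω i, ω j)) {p | p.1 = p.2} :=
        (Measure.map_apply hm hd).symm
    _ = 0 := by
      rw [h, Measure.measure_prod_null hd]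
      refine .of_forall fun a => ?_
      have : Prod.mk a ⁻¹' {p : Z × Z | p.1 = p.2} = {a} := by
        ext b
        simp [eq_comm]
      change ζ _ = 0
      rw [this]
      exact measure_singleton a

/-- Almost every point of the Bernoulli shift over `Sub_G` has the stabilizer it records. -/
theorem ae_stabilizer (η : Measure (Subgroup G)) (ζ : Measure Z)
    [IsProbabilityMeasure ζ] [NullSingletonClass ζ] :
    ∀ᵐ x ∂tensorMeasure η ζ, ∀ g : G, g • x = x → g ∈ x.1 := by
  refine ae_all_iff.2 fun g => ?_
  have hm : MeasurableSet {x : SubTensor G Z | ¬ (g • x = x → g ∈ x.1)} := by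
    have h1 : MeasurableSet {x : SubTensor G Z | g • x = x} :=
      measurableSet_eq_fun (measurable_const_smul g) measurable_id
    have h2 : MeasurableSet {x : SubTensor G Z | g ∈ x.1} :=
      (measurable_fst.comp (comap_measurable SubTensor.embed)) (measurableSet_mem g)
    exact (h1.imp h2).compl
  change tensorMeasure η ζ {x : SubTensor G Z | ¬ (g • x = x → g ∈ x.1)} = 0
  rw [tensorMeasure_apply η ζ hm]
  refine (lintegral_congr fun K => ?_).trans lintegral_zero
  refine (Measure.map_apply (measurable_mk K) hm).trans ?_
  by_cases hg : g ∈ K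
  · convert measure_empty (μ := Measure.infinitePi fun _ : G ⧸ K => ζ)
    ext ω
    simp [SubTensor.mk, hg]
  · have hne : ((g : G) : G ⧸ K) ≠ ((1 : G) : G ⧸ K) := by
      rw [ne_eq, eq_comm, QuotientGroup.eq]
      simpa using hg
    refine measure_mono_null ?_ (infinitePi_eval_eq_null ζ hne)
    intro ω hω
    simp only [mem_preimage, mem_ofPred_eq, Classical.not_imp] at hω
    -- Evaluated at the identity, `g • x = x` says that the labels of the distinct cosets `gK` and
    -- `K` coincide.
    have h := congrArg (fun x : SubTensor G Z => (SubTensor.embed x).2 1) hω.1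
    simp only [SubTensor.embed_smul, one_mul] at h
    exact h

end Stabilizers

/-! ### Approximation of partial automorphisms by codes. -/

section Approximation

theorem exists_finset_measure_diff_lt {G : Type*} [Nonempty G] [Countable G] {X : Type*}
    [MeasurableSpace X] (μ : Measure X) [IsFiniteMeasure μ] {E : G → Set X}
    (hE : ∀ g, MeasurableSet (E g)) {ε : ℝ≥0∞} (hε : 0 < ε) :
    ∃ K : Finset G, μ ((⋃ g, E g) \ ⋃ g ∈ K, E g) < ε := by
  classical
  obtain ⟨f, hf⟩ := exists_surjective_nat G
  let D : ℕ → Set X := fun n => (⋃ g, E g) \ ⋃ i ∈ Finset.range n, E (f i)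
  have hlim : Tendsto (fun n => μ (D n)) atTop (𝓝 (μ (⋂ n, D n))) := by
    refine tendsto_measure_iInter_atTop (fun n => ((MeasurableSet.iUnion hE).diff
      (Finset.measurableSet_biUnion _ fun i _ => hE _)).nullMeasurableSet) ?_
      ⟨0, measure_ne_top _ _⟩
    intro m n hmn
    exact sdiff_subset_sdiff_right (biUnion_subset_biUnion_left fun i hi =>
      Finset.mem_range.2 ((Finset.mem_range.1 hi).trans_le hmn))
  have hempty : ⋂ n, D n = ∅ := by
    refine eq_empty_of_forall_notMem fun x hx => ?_
    obtain ⟨g, hg⟩ := mem_iUnion.1 (mem_iInter.1 hx 0).1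
    obtain ⟨i, rfl⟩ := hf g
    exact (mem_iInter.1 hx (i + 1)).2 (mem_iUnion₂.2 ⟨i, by simp, hg⟩)
  rw [hempty, measure_empty] at hlim
  obtain ⟨n, hn⟩ := (hlim.eventually (gt_mem_nhds hε)).exists
  exact ⟨(Finset.range n).image f, by simpa [D] using hn⟩

variable {G : Type u} {Z : Type v} [Group G] [MeasurableSpace Z]

/-- Every Borel set is pulled back along `config`, and local events form an algebra generating the
product σ-algebra, hence are dense for the pushed-forward measure. -/
theorem exists_isLocal_approx (μ : Measure (SubTensor G Z)) [IsFiniteMeasure μ]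
    {E : Set (SubTensor G Z)} (hE : MeasurableSet E) {ε : ℝ} (hε : 0 < ε) :
    ∃ C : Set (Config G Z), IsLocal C ∧
      μ {x | ¬ (x.config ∈ C ↔ x ∈ E)} ≤ ENNReal.ofReal ε := by
  obtain ⟨B, hB, rfl⟩ := SubTensor.exists_preimage_config hE
  obtain ⟨C, hC, h⟩ := (Measure.MeasureDense.of_generateFrom_isSetAlgebra_finite
    (μ.map SubTensor.config) isSetAlgebra_isLocal generateFrom_isLocal.symm).approx B hB
    (measure_ne_top _ _) ε hε
  refine ⟨C, hC, le_trans (le_of_eq ?_) h.le⟩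
  rw [Measure.map_apply SubTensor.measurable_config (hB.symmDiff hC.measurableSet)]
  congr 1
  ext x
  simp only [mem_ofPred_eq, mem_preimage, mem_symmDiff]
  tauto

variable [Countable G] [StandardBorelSpace Z]
  {μ : Measure (SubTensor G Z)} [IsProbabilityMeasure μ]
  {hμ : ∀ g : G, MeasurePreserving (g • · : SubTensor G Z → SubTensor G Z) μ μ}

/-- Every partial automorphism is described by a code up to a set of small measure. -/
theorem exists_code_approx {s : Set (OrbitRelation G (SubTensor G Z))}
    (hs : (principalGroupoid G (SubTensor G Z) μ hμ).IsPartialAut s) {ε : ℝ} (hε : 0 < ε) :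
    ∃ c : Config G Z → Option G, IsCode c ∧
      μ {x | codeMap c x ≠ partialMap s x} ≤ ENNReal.ofReal ε := by
  classical
  -- These sets overlap when stabilizers are nontrivial. This is harmless, since any `g` giving the
  -- right point will do.
  let E : G → Set (SubTensor G Z) := fun g => {x | partialMap s x = some (g • x)}
  have hE : ∀ g, MeasurableSet (E g) := measurableSet_partialMap_eq_smul hs
  obtain ⟨K, hn⟩ := exists_finset_measure_diff_lt μ hE (ENNReal.ofReal_pos.2 (half_pos hε))
  -- Half of `ε` pays for the group elements outside `K`; the other half is shared among the
  -- approximations for `K`, with `+ 1` covering an empty `K`.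
  have hδ : 0 < ε / 2 / (K.card + 1) := by positivity
  choose B hB hBE using fun g => exists_isLocal_approx μ (hE g) hδ
  obtain ⟨c, hc, h1, h2⟩ := exists_code_of_cover K B fun g _ => hB g
  refine ⟨c, hc, ?_⟩
  have hsub : {x | codeMap c x ≠ partialMap s x} ⊆
      ((⋃ g, E g) \ ⋃ g ∈ K, E g) ∪ ⋃ g ∈ K, {x | ¬ (x.config ∈ B g ↔ x ∈ E g)} := by
    intro x hx
    by_contra hcon
    simp only [mem_union, mem_iUnion, mem_ofPred_eq, exists_prop, not_or, not_exists, not_and,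
      not_not] at hcon
    obtain ⟨hD, hK⟩ := hcon
    apply hx
    rcases e : c x.config with _ | g
    · have hnot : ∀ g, x ∉ E g := by
        intro g hg
        refine hD ⟨mem_iUnion.2 ⟨g, hg⟩, fun hx' => ?_⟩
        obtain ⟨k, hk, hx'⟩ := mem_iUnion₂.1 hx'
        exact h2 _ e _ hk ((hK _ hk).2 hx')
      rcases e' : partialMap s x with _ | y
      · simp [codeMap, e]
      · obtain ⟨g, rfl⟩ := exists_partialMap_eq_smul hs e'
        exact (hnot g e').elim
    · obtain ⟨hg, hw⟩ := h1 _ _ e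
      have : partialMap s x = some (g • x) := (hK g hg).1 hw
      simp [codeMap, e, this]
  calc _ ≤ _ := measure_mono hsub
    _ ≤ μ ((⋃ g, E g) \ ⋃ g ∈ K, E g) + ∑ g ∈ K, μ {x | ¬ (x.config ∈ B g ↔ x ∈ E g)} :=
      (measure_union_le _ _).trans (add_le_add_right (measure_biUnion_finset_le _ _) _)
    _ ≤ ENNReal.ofReal (ε / 2) + ∑ g ∈ K, ENNReal.ofReal (ε / 2 / (K.card + 1)) :=
      add_le_add hn.le (Finset.sum_le_sum fun g _ => hBE g)
    _ = ENNReal.ofReal (ε / 2 + K.card * (ε / 2 / (K.card + 1))) := by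
      rw [Finset.sum_const, nsmul_eq_mul, ENNReal.ofReal_add (by positivity) (by positivity),
        ENNReal.ofReal_mul (by positivity), ENNReal.ofReal_natCast]
    _ ≤ ENNReal.ofReal ε := by
      apply ENNReal.ofReal_le_ofReal
      have : (K.card : ℝ) * (ε / 2 / (K.card + 1)) ≤ ε / 2 := by
        rw [mul_div_assoc', div_le_iff₀ (by positivity)]
        nlinarith
      linarith

end Approximation

/-! ### Error estimates for products and traces of codes. -/

section Estimates

variable {G : Type u} {Z : Type v} [Group G] [Countable G] [MeasurableSpace Z]
  [StandardBorelSpace Z] {η : Measure (Subgroup G)} {ζ : Measure Z}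
  [IsProbabilityMeasure ζ] [NullSingletonClass ζ]

/-- A mismatch requires an error of `c₁` or `c₃` at `x`, an error of `c₂` at `T₁ x`, or a stabilizer
larger than recorded. The last has measure zero, and `hT₁` bounds the error at `T₁ x`. The maps are
abstract so that products and inverses are both covered. -/
theorem measure_mismatch_le {T₁ T₂ T₃ : SubTensor G Z → Option (SubTensor G Z)}
    {c₁ c₂ c₃ : Config G Z → Option G} {ε : ℝ} (hε : 0 ≤ ε)
    (h₁ : tensorMeasure η ζ {x | codeMap c₁ x ≠ T₁ x} ≤ ENNReal.ofReal ε)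
    (h₂ : tensorMeasure η ζ {x | codeMap c₂ x ≠ T₂ x} ≤ ENNReal.ofReal ε)
    (h₃ : tensorMeasure η ζ {x | codeMap c₃ x ≠ T₃ x} ≤ ENNReal.ofReal ε)
    (hT : ∀ x, (T₁ x).bind T₂ = T₃ x)
    (hT₁ : ∀ B, tensorMeasure η ζ {x | ∃ y ∈ B, T₁ x = some y} ≤ tensorMeasure η ζ B) :
    (tensorMeasure η ζ).real {x | x.config ∈ mismatch c₁ c₂ c₃} ≤ 3 * ε := by
  let μ := tensorMeasure η ζ
  have hsub : {x : SubTensor G Z | x.config ∈ mismatch c₁ c₂ c₃} ⊆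
      ({x | codeMap c₁ x ≠ T₁ x} ∪ {x | ∃ y ∈ {y | codeMap c₂ y ≠ T₂ y}, T₁ x = some y}) ∪
      {x | codeMap c₃ x ≠ T₃ x} ∪ {x | ¬ ∀ g : G, g • x = x → g ∈ x.1} := by
    intro x hx
    by_contra hcon
    simp only [mem_union, mem_ofPred_eq, not_or, not_not, not_exists, not_and] at hcon
    obtain ⟨⟨⟨e₁, e₂⟩, e₃⟩, hstab⟩ := hcon
    refine config_notMem_mismatch hstab ?_ hx
    rw [e₁, e₃, ← hT]
    rcases e : T₁ x with _ | y
    · rfl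
    · have : codeMap c₂ y = T₂ y := by
        by_contra h
        exact e₂ y h e
      simpa using this
  have h4 : μ {x | ¬ ∀ g : G, g • x = x → g ∈ x.1} = 0 := ae_stabilizer η ζ
  have h : μ {x | x.config ∈ mismatch c₁ c₂ c₃} ≤ ENNReal.ofReal (3 * ε) :=
    calc _ ≤ _ := measure_mono hsub
      _ ≤ μ {x | codeMap c₁ x ≠ T₁ x} + μ {x | ∃ y ∈ {y | codeMap c₂ y ≠ T₂ y}, T₁ x = some y} +
          μ {x | codeMap c₃ x ≠ T₃ x} + 0 := by
        rw [← h4]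
        refine (measure_union_le _ _).trans (add_le_add_left ?_ _)
        refine (measure_union_le _ _).trans (add_le_add_left ?_ _)
        exact measure_union_le _ _
      _ ≤ ENNReal.ofReal ε + ENNReal.ofReal ε + ENNReal.ofReal ε + 0 := by
        gcongr
        exact (hT₁ _).trans h₂
      _ = ENNReal.ofReal (3 * ε) := by
        rw [add_zero, ← ENNReal.ofReal_add hε hε, ← ENNReal.ofReal_add (by positivity) hε]
        congr 1
        ring
  exact ENNReal.toReal_le_of_le_ofReal (by positivity) h

theorem abs_measure_fixedEvent_sub_le [IsProbabilityMeasure η]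
    {T : SubTensor G Z → Option (SubTensor G Z)}
    {c : Config G Z → Option G} {ε : ℝ} (hε : 0 ≤ ε)
    (h : tensorMeasure η ζ {x | codeMap c x ≠ T x} ≤ ENNReal.ofReal ε) :
    |(tensorMeasure η ζ).real {x | x.config ∈ fixedEvent c} -
      (tensorMeasure η ζ).real {x | T x = some x}| ≤ ε := by
  let μ := tensorMeasure η ζ
  have hN : μ.real {x | codeMap c x ≠ T x} ≤ ε := ENNReal.toReal_le_of_le_ofReal hε h
  have e : μ.real {x | x.config ∈ fixedEvent c} = μ.real {x | codeMap c x = some x} := by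
    refine measureReal_congr ?_
    filter_upwards [ae_stabilizer η ζ] with x hx
    exact propext (codeMap_eq_some_self hx).symm
  change |μ.real {x | x.config ∈ fixedEvent c} - μ.real {x | T x = some x}| ≤ ε
  rw [e]
  have h1 : μ.real {x | codeMap c x = some x} ≤
      μ.real {x | T x = some x} + μ.real {x | codeMap c x ≠ T x} := by
    refine (measureReal_mono fun x hx => ?_).trans (measureReal_union_le _ _)
    by_cases hc : codeMap c x = T x
    · exact .inl (hc.symm.trans hx)
    · exact .inr hc
  have h2 : μ.real {x | T x = some x} ≤
      μ.real {x | codeMap c x = some x} + μ.real {x | codeMap c x ≠ T x} := by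
    refine (measureReal_mono fun x hx => ?_).trans (measureReal_union_le _ _)
    by_cases hc : codeMap c x = T x
    · exact .inl (hc.trans hx)
    · exact .inr hc
  exact abs_le.2 ⟨by linarith, by linarith⟩

end Estimates

/-! ## Partial automorphisms of labelled models -/

namespace FinPartialAut

variable {d : ℕ}

/-- The pairs matched by `φ` in one direction and by `φ'` in the other. -/
def ofMaps (φ φ' : Fin d → Option (Fin d)) : FinPartialAut d :=
  ⟨{p | φ p.1 = some p.2 ∧ φ' p.2 = some p.1}, by
    rintro ⟨q, r⟩ ⟨h, -⟩ ⟨q', r'⟩ ⟨h', -⟩ (rfl : q = q')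
    exact Prod.ext rfl (Option.some.inj (h.symm.trans h')), by
    rintro ⟨q, r⟩ ⟨-, h⟩ ⟨q', r'⟩ ⟨-, h'⟩ (rfl : r = r')
    exact Prod.ext (Option.some.inj (h.symm.trans h')) rfl⟩

theorem mem_ofMaps {φ φ' : Fin d → Option (Fin d)} {p : Fin d × Fin d} :
    p ∈ (ofMaps φ φ').1 ↔ φ p.1 = some p.2 ∧ φ' p.2 = some p.1 := Iff.rfl

/-- All differences lie over `E`, and over each point `f` and `g` have at most one arrow each. -/
theorem ncard_symmDiff_le (f g : FinPartialAut d) {E : Set (Fin d)}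
    (hE : ∀ q, q ∉ E → ∀ r, (q, r) ∈ f.1 ↔ (q, r) ∈ g.1) :
    (symmDiff f.1 g.1).ncard ≤ 2 * E.ncard := by
  have h : ∀ f : FinPartialAut d, (f.1 ∩ Prod.fst ⁻¹' E).ncard ≤ E.ncard := fun f =>
    ncard_le_ncard_of_injOn Prod.fst (fun p hp => hp.2) (f.2.1.mono inter_subset_left)
      (toFinite _)
  have hsub : symmDiff f.1 g.1 ⊆ (f.1 ∩ Prod.fst ⁻¹' E) ∪ (g.1 ∩ Prod.fst ⁻¹' E) := by
    rintro ⟨q, r⟩ hp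
    have hq : q ∈ E := by
      by_contra hq
      have := hE q hq r
      rcases hp with hp | hp
      · exact hp.2 (this.1 hp.1)
      · exact hp.2 (this.2 hp.1)
    exact hp.imp (fun h => ⟨h.1, hq⟩) fun h => ⟨h.1, hq⟩
  calc _ ≤ _ := ncard_le_ncard hsub (toFinite _)
    _ ≤ _ := ncard_union_le _ _
    _ ≤ E.ncard + E.ncard := add_le_add (h f) (h g)
    _ = 2 * E.ncard := (two_mul _).symm

theorem ncard_preimage_le (f : FinPartialAut d) (A : Set (Fin d)) :
    {q | ∃ r ∈ A, (q, r) ∈ f.1}.ncard ≤ A.ncard := by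
  choose! ρ hρ using fun (q : Fin d) (h : ∃ r ∈ A, (q, r) ∈ f.1) => h
  refine ncard_le_ncard_of_injOn ρ (fun q hq => (hρ q hq).1) (fun q hq q' hq' h => ?_) (toFinite _)
  have := f.2.2 (hρ q hq).2 (hρ q' hq').2 h
  exact congrArg Prod.fst this

theorem trace_eq (f : FinPartialAut d) : f.trace = ({q | (q, q) ∈ f.1}.ncard : ℝ) / d := by
  have : f.1 ∩ {p | p.1 = p.2} = (fun q => (q, q)) '' {q | (q, q) ∈ f.1} := by
    ext ⟨q, r⟩
    constructor
    · rintro ⟨h, (rfl : q = r)⟩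
      exact ⟨q, h, rfl⟩
    · rintro ⟨q', h, e⟩
      obtain ⟨rfl, rfl⟩ := Prod.mk.inj e
      exact ⟨h, rfl⟩
  rw [trace, size, this, ncard_image_of_injective _ fun q q' h => congrArg Prod.fst h]

theorem abs_trace_sub_le (f : FinPartialAut d) {A E : Set (Fin d)}
    (hE : ∀ q ∉ A, (q, q) ∈ f.1 ↔ q ∈ E) :
    |f.trace - (E.ncard : ℝ) / d| ≤ (A.ncard : ℝ) / d := by
  rw [trace_eq, ← sub_div, abs_div, Nat.abs_cast]
  refine div_le_div_of_nonneg_right ?_ (Nat.cast_nonneg d)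
  have h1 : {q | (q, q) ∈ f.1}.ncard ≤ E.ncard + A.ncard := by
    refine (ncard_le_ncard (fun q hq => ?_) (toFinite _)).trans (ncard_union_le _ _)
    by_cases hA : q ∈ A
    · exact .inr hA
    · exact .inl ((hE q hA).1 hq)
  have h2 : E.ncard ≤ {q | (q, q) ∈ f.1}.ncard + A.ncard := by
    refine (ncard_le_ncard (fun q hq => ?_) (toFinite _)).trans (ncard_union_le _ _)
    by_cases hA : q ∈ A
    · exact .inr hA
    · exact .inl ((hE q hA).2 hq)
  have h1' : ({q | (q, q) ∈ f.1}.ncard : ℝ) ≤ E.ncard + A.ncard := by exact_mod_cast h1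
  have h2' : (E.ncard : ℝ) ≤ {q | (q, q) ∈ f.1}.ncard + A.ncard := by exact_mod_cast h2
  exact abs_le.2 ⟨by linarith, by linarith⟩

/-- If `φ` followed by `ψ` is `χ` and `φ'`, `ψ'`, `χ'` are the inverse maps outside of small sets,
then the associated partial automorphisms are almost multiplicative. -/
theorem ncard_symmDiff_ofMaps_le {φ φ' ψ ψ' χ χ' : Fin d → Option (Fin d)} {A B C M : Set (Fin d)}
    (hφ : ∀ q ∉ A, ∀ r, φ q = some r → φ' r = some q)
    (hψ : ∀ q ∉ B, ∀ r, ψ q = some r → ψ' r = some q)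
    (hχ : ∀ q ∉ C, ∀ r, χ q = some r → χ' r = some q)
    (hM : ∀ q ∉ M, (φ q).bind ψ = χ q) :
    (symmDiff (ofMaps χ χ').1 (ofMaps φ φ' * ofMaps ψ ψ').1).ncard ≤
      2 * (A.ncard + B.ncard + C.ncard + M.ncard) := by
  -- The map `ψ` is applied at `φ q`, so its bad set must be pulled back. Under `φ` alone the
  -- preimage could be large; along matched pairs, which are injective, it has at most as many
  -- points as `B`.
  have hcount := ncard_preimage_le (ofMaps φ φ') B
  refine (ncard_symmDiff_le _ _
    (E := A ∪ {q | ∃ r ∈ B, (q, r) ∈ (ofMaps φ φ').1} ∪ C ∪ M) fun q hq r => ?_).trans ?_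
  · simp only [mem_union, not_or, mem_ofPred_eq, not_exists, not_and] at hq
    obtain ⟨⟨⟨hA, hB⟩, hC⟩, hqM⟩ := hq
    have e := hM q hqM
    constructor
    · rintro ⟨h, -⟩
      change χ q = some r at h
      rw [← e, Option.bind_eq_some_iff] at h
      obtain ⟨j, h1, h2⟩ := h
      have hj : (q, j) ∈ (ofMaps φ φ').1 := ⟨h1, hφ q hA j h1⟩
      exact ⟨j, hj, h2, hψ j (fun h => hB j h hj) r h2⟩
    · rintro ⟨j, ⟨h1, -⟩, h2, -⟩
      have h : χ q = some r := by
        rw [← e]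
        exact Option.bind_eq_some_iff.2 ⟨j, h1, h2⟩
      exact ⟨h, hχ q hC r h⟩
  · have h1 := ncard_union_le (A ∪ {q | ∃ r ∈ B, (q, r) ∈ (ofMaps φ φ').1} ∪ C) M
    have h2 := ncard_union_le (A ∪ {q | ∃ r ∈ B, (q, r) ∈ (ofMaps φ φ').1}) C
    have h3 := ncard_union_le A {q | ∃ r ∈ B, (q, r) ∈ (ofMaps φ φ').1}
    omega

end FinPartialAut

/-! ## Sofic approximations from deterministic maps -/

namespace PMPGroupoid

variable {Ob : Type u} {H : Type v} [MeasurableSpace Ob] [StandardBorelSpace Ob]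
  [MeasurableSpace H] [StandardBorelSpace H] (𝓗 : PMPGroupoid Ob H)

/-- The σ-algebra on maps is generated by finite cylinders, and `{τ}` need not be measurable. The
cylinder of `τ` over `F` is measurable, which suffices for properties determined by the values on
`F`. -/
theorem ae_dirac_of_finite {d : ℕ} (τ : 𝓗.MapTo d) (F : Finset 𝓗.PartialAut)
    {p : 𝓗.MapTo d → Prop} (hp : ∀ τ', (∀ s ∈ F, τ' s = τ s) → p τ') :
    ∀ᵐ τ' ∂Measure.dirac τ, p τ' := by
  have hm : MeasurableSet {τ' : 𝓗.MapTo d | ∀ s ∈ F, τ' s = τ s} :=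
    MeasurableSpace.measurableSet_generateFrom ⟨τ, F, rfl⟩
  filter_upwards [(ae_dirac_iff hm).2 fun s _ => rfl] with τ' h using hp τ' h

/-- A groupoid is sofic if there are approximately multiplicative and trace-preserving maps that do
not distinguish partial automorphisms which agree almost everywhere. -/
theorem isSofic_of_exists_map
    (h : ∀ (F : Finset 𝓗.PartialAut) (δ : ℝ), 0 < δ → ∀ N : ℕ, ∃ d, N ≤ d ∧ 0 < d ∧
      ∃ τ : 𝓗.MapTo d, 𝓗.IsMultiplicative τ F δ ∧ 𝓗.IsTracePreserving τ F δ ∧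
        ∀ f f' : 𝓗.PartialAut, 𝓗.mass (symmDiff f.1 f'.1) = 0 → τ f = τ f') : 𝓗.IsSofic := by
  classical
  -- An index `(F, n)` stands for the finite set `F`, the tolerance `1 / (n + 1)` and the size bound
  -- `n ≤ d`, so every larger index satisfies at least the same requirements.
  choose d hN hd τ hmul htr hnull using
    fun j : Finset 𝓗.PartialAut × ℕ => h j.1 (1 / (j.2 + 1)) Nat.one_div_pos_of_nat j.2
  have hlt : ∀ {δ : ℝ}, 0 < δ → ∃ n : ℕ, ∀ m, n ≤ m → 1 / ((m : ℝ) + 1) < δ := fun hδ => by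
    obtain ⟨n, hn⟩ := exists_nat_one_div_lt hδ
    exact ⟨n, fun m hm => (Nat.one_div_le_one_div hm).trans_lt hn⟩
  refine ⟨Finset 𝓗.PartialAut × ℕ, inferInstance, inferInstance, inferInstance, d,
    fun j => Measure.dirac (τ j), hd, fun j => inferInstance, fun F δ hδ => ?_, fun F δ hδ => ?_,
    ?_, fun f f' hff' j => ?_⟩
  · obtain ⟨n, hn⟩ := hlt hδ
    refine tendsto_const_nhds.congr' ?_
    filter_upwards [eventually_ge_atTop (F, n)] with j hj
    have : ∀ᵐ τ' ∂Measure.dirac (τ j), 𝓗.IsTracePreserving τ' F δ := by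
      refine 𝓗.ae_dirac_of_finite _ F fun τ' hτ' s hs => ?_
      rw [hτ' s hs]
      exact (htr j s (hj.1 hs)).trans (hn _ hj.2)
    rw [measure_congr (eventuallyEq_univ.2 this), measure_univ]
  · obtain ⟨n, hn⟩ := hlt hδ
    refine ⟨(F, n), fun j hj => ?_⟩
    refine 𝓗.ae_dirac_of_finite _ (F ∪ (F ×ˢ F).image fun p => p.1 * p.2) fun τ' hτ' s hs t ht => ?_
    rw [hτ' s (Finset.mem_union_left _ hs), hτ' t (Finset.mem_union_left _ ht),
      hτ' (s * t) (Finset.mem_union_right _ (Finset.mem_image.2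
        ⟨(s, t), Finset.mem_product.2 ⟨hs, ht⟩, rfl⟩))]
    exact (hmul j s (hj.1 hs) t (hj.1 ht)).trans (hn _ hj.2)
  · refine tendsto_atTop.2 fun N => ?_
    filter_upwards [eventually_ge_atTop (∅, N)] with j hj
    exact hj.2.trans (hN j)
  · refine 𝓗.ae_dirac_of_finite _ {f, f'} fun τ' hτ' => ?_
    rw [hτ' f (by simp), hτ' f' (by simp), hnull j f f' hff']

end PMPGroupoid

/-! ### The approximating maps for the Bernoulli shift. -/

section Main

variable {G : Type u} [Group G] [Countable G] {Z : Type v} [MeasurableSpace Z]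
  [StandardBorelSpace Z] (ζ : Measure Z) [IsProbabilityMeasure ζ]
  (η : Measure (Subgroup G)) [IsProbabilityMeasure η] (hη : IsConjInvariant η)

/-- The principal groupoid of the non-free Bernoulli shift. -/
abbrev bernoulliGroupoid : PMPGroupoid (SubTensor G Z) (OrbitRelation G (SubTensor G Z)) :=
  principalGroupoid G (SubTensor G Z) (tensorMeasure η ζ)
    (measurePreserving_smul_tensorMeasure η hη ζ)

/-- Codes for all partial automorphisms and their inverses that depend only on the class of the
partial automorphism modulo null sets. -/
theorem exists_codes {ε : ℝ} (hε : 0 < ε) :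
    ∃ c c' : (bernoulliGroupoid ζ η hη).PartialAut → Config G Z → Option G,
      (∀ s, IsCode (c s)) ∧ (∀ s, IsCode (c' s)) ∧
      (∀ s, tensorMeasure η ζ {x | codeMap (c s) x ≠ partialMap s.1 x} ≤ ENNReal.ofReal ε) ∧
      (∀ s, ∃ t : (bernoulliGroupoid ζ η hη).PartialAut,
        tensorMeasure η ζ {x | codeMap (c s) x ≠ partialMap t.1 x} ≤ ENNReal.ofReal ε ∧
        tensorMeasure η ζ {x | codeMap (c' s) x ≠
          partialMap ((bernoulliGroupoid ζ η hη).inv ⁻¹' t.1) x} ≤ ENNReal.ofReal ε) ∧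
      ∀ s t : (bernoulliGroupoid ζ η hη).PartialAut,
        (bernoulliGroupoid ζ η hη).mass (symmDiff s.1 t.1) = 0 → c s = c t ∧ c' s = c' t := by
  let r : Setoid (bernoulliGroupoid ζ η hη).PartialAut :=
    { r := fun s t => partialMap s.1 =ᵐ[tensorMeasure η ζ] partialMap t.1
      iseqv := ⟨fun _ => .rfl, fun h => h.symm, fun h h' => h.trans h'⟩ }
  choose k hk hk' using fun s : (bernoulliGroupoid ζ η hη).PartialAut => exists_code_approx s.2 hε
  choose k' hl hl' using fun s : (bernoulliGroupoid ζ η hη).PartialAut =>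
    exists_code_approx (isPartialAut_inv s.2) hε
  -- Both codes of `s` are those of a representative of its class, so they are literally equal for
  -- maps that agree almost everywhere. The inverse code thus belongs to the inverse of the
  -- representative rather than of `s`, hence the auxiliary `t` in the statement.
  let rep : (bernoulliGroupoid ζ η hη).PartialAut → (bernoulliGroupoid ζ η hη).PartialAut :=
    fun s => (Quotient.mk r s).out
  have hrep : ∀ s, partialMap (rep s).1 =ᵐ[tensorMeasure η ζ] partialMap s.1 :=
    fun s => Quotient.exact (s := r) (Quotient.out_eq (Quotient.mk r s))
  refine ⟨fun s => k (rep s), fun s => k' (rep s), fun s => hk _, fun s => hl _, fun s => ?_,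
    fun s => ⟨rep s, hk' _, hl' _⟩, fun s t hst => ?_⟩
  · refine (measure_mono_ae ?_).trans (hk' (rep s))
    filter_upwards [hrep s] with x hx h
    exact fun h' => h (h'.trans hx)
  · have : rep s = rep t := congrArg Quotient.out
      (Quotient.sound (s := r) (partialMap_ae_eq s.2 t.2 hst))
    exact ⟨congrArg k this, congrArg k' this⟩

variable [NullSingletonClass ζ]

theorem measure_mismatch_mul_le {s t u : (bernoulliGroupoid ζ η hη).PartialAut} (hu : u = s * t)
    {c₁ c₂ c₃ : Config G Z → Option G} {ε : ℝ} (hε : 0 ≤ ε)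
    (h₁ : tensorMeasure η ζ {x | codeMap c₁ x ≠ partialMap s.1 x} ≤ ENNReal.ofReal ε)
    (h₂ : tensorMeasure η ζ {x | codeMap c₂ x ≠ partialMap t.1 x} ≤ ENNReal.ofReal ε)
    (h₃ : tensorMeasure η ζ {x | codeMap c₃ x ≠ partialMap u.1 x} ≤ ENNReal.ofReal ε) :
    (tensorMeasure η ζ).real {x | x.config ∈ mismatch c₁ c₂ c₃} ≤ 3 * ε := by
  subst hu
  exact measure_mismatch_le hε h₁ h₂ h₃ (fun x => (partialMap_setMul s.2 t.2 x).symm)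
    (measure_partialMap_le s.2)

/-- Following `s` by its inverse gives the identity on the domain of `s`. Its code `domCode c` errs
only where `c` does. -/
theorem measure_mismatch_inv_le {s : (bernoulliGroupoid ζ η hη).PartialAut}
    {c c' : Config G Z → Option G} {ε : ℝ} (hε : 0 ≤ ε)
    (h : tensorMeasure η ζ {x | codeMap c x ≠ partialMap s.1 x} ≤ ENNReal.ofReal ε)
    (h' : tensorMeasure η ζ {x | codeMap c' x ≠
      partialMap ((bernoulliGroupoid ζ η hη).inv ⁻¹' s.1) x} ≤ ENNReal.ofReal ε) :
    (tensorMeasure η ζ).real {x | x.config ∈ mismatch c c' (domCode c)} ≤ 3 * ε := by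
  have h₃ : tensorMeasure η ζ {x | codeMap (domCode c) x ≠
      (partialMap s.1 x).map fun _ => x} ≤ ENNReal.ofReal ε := by
    refine (measure_mono ?_).trans h
    intro x hx hcx
    refine hx ?_
    rw [codeMap_domCode, hcx]
  refine measure_mismatch_le hε h h' h₃ (fun x => ?_) (measure_partialMap_le s.2)
  rcases e : partialMap s.1 x with _ | y
  · rfl
  · exact partialMap_inv s.2 e

theorem exists_approximating_map (hsofic : IsSoficIRS η)
    (F : Finset (bernoulliGroupoid ζ η hη).PartialAut) (δ : ℝ) (hδ : 0 < δ) (N : ℕ) :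
    ∃ d, N ≤ d ∧ 0 < d ∧ ∃ τ : (bernoulliGroupoid ζ η hη).MapTo d,
      (bernoulliGroupoid ζ η hη).IsMultiplicative τ F δ ∧
      (bernoulliGroupoid ζ η hη).IsTracePreserving τ F δ ∧
      ∀ f f' : (bernoulliGroupoid ζ η hη).PartialAut,
        (bernoulliGroupoid ζ η hη).mass (symmDiff f.1 f'.1) = 0 → τ f = τ f' := by
  classical
  let μ := tensorMeasure η ζ
  -- Each set `A s` or `B s t` has fewer than `5 * ε * d` points: `3 * ε` from the measure of the
  -- mismatch, `ε` from its frequency and `ε` from bad points. Multiplicativity uses four such sets,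
  -- doubled; the trace costs only `7 * ε`.
  let ε : ℝ := δ / 40
  have hε : 0 < ε := by positivity
  obtain ⟨c, c', hc, hc', happ, hinv, hnull⟩ := exists_codes ζ η hη hε
  -- The code of a product `s * t` must also be almost inverted by its partner.
  let F' := F ∪ (F ×ˢ F).image fun p => p.1 * p.2
  let MM := fun s t => mismatch (c s) (c t) (c (s * t))
  let MI := fun s => mismatch (c s) (c' s) (domCode (c s))
  choose S hS using fun s t => exists_modelMap_bind (hc s) (hc t) (hc (s * t))
  choose S' hS' using fun s => exists_modelMap_bind (hc s) (hc' s) (hc s).domCode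
  obtain ⟨d, hN, hd, σ, z, hfreq, hbad⟩ := exists_labelled_model ζ η hsofic
    (((F ×ˢ F).image fun p => MM p.1 p.2) ∪ F'.image MI ∪ F.image fun s => fixedEvent (c s))
    (fun C hC => by
      simp only [Finset.mem_union, Finset.mem_image] at hC
      rcases hC with (⟨p, -, rfl⟩ | ⟨s, -, rfl⟩) | ⟨s, -, rfl⟩
      · exact isLocal_mismatch (hc _) (hc _) (hc _)
      · exact isLocal_mismatch (hc _) (hc' _) (hc _).domCode
      · exact isLocal_fixedEvent (hc _))
    ({(1, 1)} ∪ ((F ×ˢ F).biUnion fun p => S p.1 p.2) ∪ F'.biUnion S') hε N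
  have hd0 : (0 : ℝ) < d := by exact_mod_cast hd
  let R : Finset (G × G) := {(1, 1)} ∪ ((F ×ˢ F).biUnion fun p => S p.1 p.2) ∪ F'.biUnion S'
  let bad : Set (Fin d) := {q | ∃ p ∈ R, σ p.1 (σ p.2 q) ≠ σ (p.1 * p.2) q}
  have hgood : ∀ q ∉ bad, ∀ p ∈ R, σ p.1 (σ p.2 q) = σ (p.1 * p.2) q := fun q hq p hp => by
    by_contra h
    exact hq ⟨p, hp, h⟩
  have hbad' : (bad.ncard : ℝ) < ε * d := (div_lt_iff₀ hd0).1 hbad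
  let φ := fun s => modelMap σ z (c s)
  let φ' := fun s => modelMap σ z (c' s)
  let A := fun s => bad ∪ {q | labelConfig σ z q ∈ MI s}
  let B := fun s t => bad ∪ {q | labelConfig σ z q ∈ MM s t}
  have hA : ∀ s ∈ F', ∀ q ∉ A s, ∀ r, φ s q = some r → φ' s r = some q := by
    intro s hs q hq r hr
    simp only [A, mem_union, not_or] at hq
    have hg := hgood q hq.1
    have h := hS' s d σ z q (fun p hp => hg p (Finset.mem_union_right _
      (Finset.mem_biUnion.2 ⟨s, hs, hp⟩))) hq.2
    -- Nothing forces `σ 1` to be the identity. The pair `(1, 1)` gives `σ 1 (σ 1 q) = σ 1 q`, and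
    -- `σ 1` is injective.
    have h1 : σ 1 q = q := by
      have := hg (1, 1) (by simp [R])
      simpa using this
    rw [modelMap_domCode_eq_some hr, h1] at h
    change (φ s q).bind (φ' s) = some q at h
    rwa [hr] at h
  have hB : ∀ s ∈ F, ∀ t ∈ F, ∀ q ∉ B s t, (φ s q).bind (φ t) = φ (s * t) q := by
    intro s hs t ht q hq
    simp only [B, mem_union, not_or] at hq
    exact hS s t d σ z q (fun p hp => hgood q hq.1 p (Finset.mem_union_left _
      (Finset.mem_union_right _ (Finset.mem_biUnion.2
        ⟨(s, t), Finset.mem_product.2 ⟨hs, ht⟩, hp⟩)))) hq.2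
  have hcard : ∀ C : Set (Config G Z), μ.real {x | x.config ∈ C} ≤ 3 * ε →
      |({q | labelConfig σ z q ∈ C}.ncard : ℝ) / d - μ.real {x | x.config ∈ C}| < ε →
      ((bad ∪ {q | labelConfig σ z q ∈ C}).ncard : ℝ) < 5 * ε * d := by
    intro C h1 h2
    have h3 : ({q | labelConfig σ z q ∈ C}.ncard : ℝ) / d < 4 * ε := by
      linarith [(abs_lt.1 h2).2]
    rw [div_lt_iff₀ hd0] at h3
    have h4 : ((bad ∪ {q | labelConfig σ z q ∈ C}).ncard : ℝ) ≤
        bad.ncard + {q | labelConfig σ z q ∈ C}.ncard := by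
      exact_mod_cast ncard_union_le _ _
    linarith
  have hAc : ∀ s ∈ F', ((A s).ncard : ℝ) < 5 * ε * d := by
    intro s hs
    obtain ⟨t, h1, h2⟩ := hinv s
    exact hcard _ (measure_mismatch_inv_le ζ η hη hε.le h1 h2) (hfreq _ (Finset.mem_union_left _
      (Finset.mem_union_right _ (Finset.mem_image_of_mem _ hs))))
  have hBc : ∀ s ∈ F, ∀ t ∈ F, ((B s t).ncard : ℝ) < 5 * ε * d := by
    intro s hs t ht
    exact hcard _ (measure_mismatch_mul_le ζ η hη rfl hε.le (happ s) (happ t) (happ (s * t)))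
      (hfreq _ (Finset.mem_union_left _ (Finset.mem_union_left _ (Finset.mem_image.2
        ⟨(s, t), Finset.mem_product.2 ⟨hs, ht⟩, rfl⟩))))
  refine ⟨d, hN, hd, fun s => .ofMaps (φ s) (φ' s), ?_, ?_, ?_⟩
  · intro s hs t ht
    have hsF : s ∈ F' := Finset.mem_union_left _ hs
    have htF : t ∈ F' := Finset.mem_union_left _ ht
    have hstF : s * t ∈ F' := Finset.mem_union_right _ (Finset.mem_image.2
      ⟨(s, t), Finset.mem_product.2 ⟨hs, ht⟩, rfl⟩)
    have h := FinPartialAut.ncard_symmDiff_ofMaps_le (hA s hsF) (hA t htF) (hA _ hstF)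
      (hB s hs t ht)
    have h' : ((symmDiff (FinPartialAut.ofMaps (φ (s * t)) (φ' (s * t))).1
        (FinPartialAut.ofMaps (φ s) (φ' s) * FinPartialAut.ofMaps (φ t) (φ' t)).1).ncard : ℝ) ≤
        2 * ((A s).ncard + (A t).ncard + (A (s * t)).ncard + (B s t).ncard) := by
      exact_mod_cast h
    rw [FinPartialAut.size, div_lt_iff₀ hd0]
    have e : δ = 40 * ε := by simp only [ε]; ring
    rw [e]
    linarith [hAc s hsF, hAc t htF, hAc _ hstF, hBc s hs t ht]
  · intro s hs
    have hsF : s ∈ F' := Finset.mem_union_left _ hs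
    have h1 := FinPartialAut.abs_trace_sub_le (FinPartialAut.ofMaps (φ s) (φ' s)) (A := A s)
      (E := {q | labelConfig σ z q ∈ fixedEvent (c s)}) fun q hq => by
        rw [mem_ofPred_eq, ← modelMap_eq_some_self, FinPartialAut.mem_ofMaps]
        exact ⟨fun h => h.1, fun h => ⟨h, hA s hsF q hq q h⟩⟩
    have h2 := hfreq (fixedEvent (c s)) (Finset.mem_union_right _ (Finset.mem_image_of_mem _ hs))
    have h3 := abs_measure_fixedEvent_sub_le hε.le (happ s)
    have h4 : ((A s).ncard : ℝ) / d < 5 * ε := (div_lt_iff₀ hd0).2 (hAc s hsF)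
    rw [trace_eq]
    have e : δ = 40 * ε := by simp only [ε]; ring
    have := abs_le.1 h1
    have := abs_lt.1 h2
    have := abs_le.1 h3
    rw [e]
    exact abs_lt.2 ⟨by linarith, by linarith⟩
  · intro f f' hff'
    obtain ⟨h1, h2⟩ := hnull f f' hff'
    simp only [φ, φ', h1, h2]

end Main

end SoficGroupoid

end


open SoficGroupoid in
theorem proposition13p5 {G : Type u} [Group G] [Countable G]
    {Z : Type v} [MeasurableSpace Z] [StandardBorelSpace Z]
    (ζ : Measure Z) [IsProbabilityMeasure ζ] [NullSingletonClass ζ]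
    (η : Measure (Subgroup G)) [IsProbabilityMeasure η]
    (hη : IsConjInvariant η) (hsofic : IsSoficIRS η) :
    (principalGroupoid G (SubTensor G Z) (tensorMeasure η ζ)
      (measurePreserving_smul_tensorMeasure η hη ζ)).IsSofic := by
  exact PMPGroupoid.isSofic_of_exists_map _ (exists_approximating_map ζ η hη hsofic)
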